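/- For integers $p_1,\dots,p_n$ ($n\ge 1$) let $L(p_1,\dots,p_n)$ be the $n$-pretzel link given by its standard diagram: $n$ vertical columns (boxes) of $|p_i|$ crossings (half twists), the right strand of each column being joined at the top and at the bottom to the left strand of the next one, and the right strand of the last column to the left strand of the first one. The sign of $p_i$ is chosen so that, for $p_i>0$, the crossings of the $i$-th column are right-handed when its two strands are oriented in parallel. Let $\nabla_L(z)\in\mathbb Z[z]$ be the Conway polynomial of an oriented link $L$, normalised by $\nabla_{\text{unknot}}=1$ and $\nabla_{L_+}-\nabla_{L_-}=z\nabla_{L_0}$, and let $\nabla_m$ be the Conway polynomial of the torus link $T_{(2,m)}$, $m\in\mathbb Z$, the closure of the 2-braid $\sigma_1^m$ with parallel strands and with right-handed crossings for $m>0$. For $m\in\mathbb Z$, $m\neq 0$, put $m'=\operatorname{sign}(m)(|m|-1)$. Let $o_i$ denote odd integers and $e_1$ an even integer, and put $\alpha=\sum_{i=2}^n\operatorname{sign}(o_i)$ and $\beta=\operatorname{sign}(e_1)$. Then the Conway polynomials of the $n$-pretzel knots, and of the two-component pretzel links with all $o_i$ odd, are as follows. 1. If $n$ is odd, then for either orientation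 of the knot $L(o_1,\dots,o_n)$ there are integers $a_0,\dots,a_{(n-1)/2}$ with $$\nabla_{L(o_1,\dots,o_n)}=\sum_{i=0}^{(n-1)/2}a_i z^{2i}.$$ 2. If $n$ is odd and $e_1=2l$, then for either orientation of the knot $L(e_1,o_2,\dots,o_n)$ $$\nabla_{L(e_1,o_2,\dots,o_n)}=\nabla_{o_2}\cdots\nabla_{o_n}\Bigl[1-lz\Bigl[\frac{\alpha}{2}z+\sum_{i=2}^n\frac{\nabla_{o_i'}}{\nabla_{o_i}}\Bigr]\Bigr].$$ 3. If $n$ is even and $e_1\neq 0$, then for either orientation of the knot $L(e_1,o_2,\dots,o_n)$ $$\nabla_{L(e_1,o_2,\dots,o_n)}=\nabla_{o_2}\cdots\nabla_{o_n}\Bigl[\nabla_{e_1'}+\nabla_{e_1}\Bigl[\frac{\alpha+\beta}{2}z+\sum_{i=2}^n\frac{\nabla_{o_i'}}{\nabla_{o_i}}\Bigr]\Bigr].$$ 4. If $n$ is even and the two-component link $L(o_1,\dots,o_n)$ is oriented so that the two strands run in opposite directions in every box, then there are integers $a_1,\dots,a_{n/2}$ with $$\nabla_{L(o_1,\dots,o_n)}=\sum_{i=1}^{n/2}a_i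 z^{2i-1}.$$ 5. If $n$ is even and the two-component link $L(o_1,\dots,o_n)$ is oriented so that the two strands run in the same direction in every box, then $$\nabla_{L(o_1,\dots,o_n)}=\nabla_{o_1}\cdots\nabla_{o_n}\Bigl[\frac{1}{2}\Bigl(\sum_{i=1}^n\operatorname{sign}(o_i)\Bigr)z+\sum_{i=1}^n\frac{\nabla_{o_i'}}{\nabla_{o_i}}\Bigr].$$ The formulas in 2, 3 and 5 are identities of rational functions in $z$. -/

import Mathlib

open scoped Polynomial LaurentPolynomial

/-! ### Link diagrams -/

/-- A link diagram on the sphere, encoded as a combinatorial map. The vertices are crossings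
(four ends of edges) and joints (two ends of edges; a joint only subdivides an arc, so that
crossingless circles and arcs need no special treatment). The four *darts* `(c, 0), …, (c, 3)` at
a crossing `c` are listed in counterclockwise order; the strand through `(c, 0)` and `(c, 2)` is the
over-strand exactly when `firstOver c = true`. Every edge has two ends, and every dart is the end of
exactly one edge. -/
structure LinkDiagram where
  Crossing : Type
  Joint : Type
  Edge : Type
  [fintypeCrossing : Fintype Crossing]
  [decEqCrossing : DecidableEq Crossing]
  [finiteJoint : Finite Joint]
  firstOver : Crossing → Bool
  ends : Edge → Bool → (Crossing × Fin 4) ⊕ (Joint × Bool)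
  ends_bijective : Function.Bijective fun x : Edge × Bool => ends x.1 x.2

namespace LinkDiagram

attribute [instance] fintypeCrossing decEqCrossing finiteJoint

variable (D : LinkDiagram)

/-- The darts (ends of edges at the vertices) of a diagram. -/
abbrev Dart : Type := (D.Crossing × Fin 4) ⊕ (D.Joint × Bool)

/-- The next dart at the same vertex in clockwise direction. -/
def prev : D.Dart → D.Dart
  | .inl (c, k) => .inl (c, k - 1)
  | .inr (j, b) => .inr (j, !b)

/-- A dart also names the corner of its vertex that follows it counterclockwise. Travelling along an
edge `e` from one of its ends to the other, the corner following the first end and the corner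
preceding the second end both lie on the left of `e`. -/
def SameSide (x y : D.Dart) : Prop :=
  ∃ (e : D.Edge) (b : Bool), x = D.ends e b ∧ y = D.prev (D.ends e (!b))

/-- The regions (faces) of the diagram: classes of corners. -/
def Region : Type := Quot D.SameSide

/-- The region containing the corner that follows the given dart counterclockwise. -/
def region (x : D.Dart) : D.Region := Quot.mk _ x

/-- An orientation of the link: `out x` says that the strand leaves the vertex along the dart
`x`. Strands go straight through crossings and joints. -/
structure Orientation where
  out : D.Dart → Bool
  edge : ∀ e, out (D.ends e true) = !out (D.ends e false)
  crossing : ∀ c k, out (.inl (c, k + 2)) = !out (.inl (c, k))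
  joint : ∀ j, out (.inr (j, true)) = !out (.inr (j, false))

variable {D}

/-- The sign of a crossing: `1` if the direction of the over-strand becomes the direction of the
under-strand by a counterclockwise quarter turn (right-handed crossing), and `-1` otherwise. -/
def Orientation.crossingSign (o : D.Orientation) (c : D.Crossing) : ℤ :=
  if (o.out (.inl (c, 0)) = o.out (.inl (c, 1)) ↔ D.firstOver c = true) then 1 else -1

/-- The weight of the `k`-th corner of the crossing `c`, of sign `ε`: `q ^ ε` for the corner between
the two outgoing darts, `-q ^ (-ε)` for the corner between the two incoming darts, and `1`
for the other two corners. -/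
noncomputable def Orientation.weight (o : D.Orientation) (c : D.Crossing) (k : Fin 4) : ℤ[T;T⁻¹] :=
  match o.out (.inl (c, k)), o.out (.inl (c, k + 1)) with
  | true, true => LaurentPolynomial.T (o.crossingSign c)
  | false, false => -LaurentPolynomial.T (-o.crossingSign c)
  | _, _ => 1

/-- The region `r` lies on one of the two sides of the edge `e`. -/
def IsBeside (e : D.Edge) (r : D.Region) : Prop :=
  r = D.region (D.ends e false) ∨ r = D.region (D.ends e true)

/-- Kauffman states relative to the base edge `e`: a choice of one corner at each crossing such that
the two regions beside `e` are not chosen, and each other region is chosen exactly once. -/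
def IsState (e : D.Edge) (m : D.Crossing → Fin 4) : Prop :=
  (∀ c, ¬ IsBeside e (D.region (.inl (c, m c)))) ∧
    ∀ r : D.Region, ¬ IsBeside e r → ∃! c, D.region (.inl (c, m c)) = r

open scoped Classical in
/-- Kauffman's state sum, with base edge `e`. -/
noncomputable def Orientation.stateSum (o : D.Orientation) (e : D.Edge) : ℤ[T;T⁻¹] :=
  ∑ m : D.Crossing → Fin 4, if IsState e m then ∏ c, o.weight c (m c) else 0

/-- `P ∈ ℤ[z]` is the Conway polynomial of the oriented link with the given diagram: the state sum
equals `P(q - q⁻¹)`. This is Kauffman's state model of the Conway polynomial normalised by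
`∇(unknot) = 1` and `∇(L₊) - ∇(L₋) = z ∇(L₀)`. For diagrams on the sphere the
state sum does not depend on the base edge. As `q - q⁻¹` is transcendental, `P` is unique. -/
def Orientation.HasConwayPolynomial (o : D.Orientation) (e : D.Edge) (P : ℤ[X]) : Prop :=
  Polynomial.aeval (LaurentPolynomial.T 1 - LaurentPolynomial.T (-1) : ℤ[T;T⁻¹]) P = o.stateSum e

open scoped Classical in
/-- The Conway polynomial of an oriented link diagram. -/
noncomputable def Orientation.conway (o : D.Orientation) (e : D.Edge) : ℤ[X] :=
  if h : ∃ P, o.HasConwayPolynomial e P then h.choose else 0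

end LinkDiagram

/-! ### Columns of half twists

A vertical column of `m` crossings has two strands at each of the levels `0, …, m`, counted from
the bottom; the crossing `k` lies between the levels `k` and `k + 1`. The side `false` is the left
and `true` is the right. The darts of a crossing point to the
north-east (`0`), north-west (`1`), south-west (`2`) and south-east (`3`). -/

/-- The dart at the lower end of the edge at level `k` on side `s`: either the given joint dart, or
the upper dart on side `s` of the crossing below. -/
def columnLower {α : Type} {m : ℕ} (crossing : Fin m → Fin 4 → α) (joint : α) (k : Fin (m + 1))
    (s : Bool) : α :=
  Fin.cases joint (fun c => crossing c (if s then 0 else 1)) k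

/-- The dart at the upper end of the edge at level `k` on side `s`: either the given joint dart, or
the lower dart on side `s` of the crossing above. -/
def columnUpper {α : Type} {m : ℕ} (crossing : Fin m → Fin 4 → α) (joint : α) (k : Fin (m + 1))
    (s : Bool) : α :=
  Fin.lastCases joint (fun c => crossing c (if s then 3 else 2)) k

/-! ### The torus links `T(2, m)` -/

/-- The ends of the edges of the closed 2-braid `σ₁ ^ m`. The joint `s` closes the strand position
`s`; its dart `true` meets the top and its dart `false` the bottom of the column. -/
def torusEnds (m : ℤ) (e : Fin (m.natAbs + 1) × Bool) (b : Bool) :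
    (Fin m.natAbs × Fin 4) ⊕ (Bool × Bool) :=
  if b then columnUpper (fun c d => .inl (c, d)) (.inr (e.2, true)) e.1 e.2
  else columnLower (fun c d => .inl (c, d)) (.inr (e.2, false)) e.1 e.2

theorem torusEnds_bijective (m : ℤ) :
    Function.Bijective fun x : (Fin (m.natAbs + 1) × Bool) × Bool => torusEnds m x.1 x.2 := by
  constructor
  · rintro ⟨⟨k, s⟩, b⟩ ⟨⟨k', s'⟩, b'⟩ h
    cases b <;> cases b'
    · induction k using Fin.cases <;> induction k' using Fin.cases <;> cases s <;> cases s' <;>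
        simp_all [torusEnds, columnLower]
    · induction k using Fin.cases <;> induction k' using Fin.lastCases <;> cases s <;> cases s' <;>
        simp_all [torusEnds, columnLower, columnUpper]
    · induction k using Fin.lastCases <;> induction k' using Fin.cases <;> cases s <;> cases s' <;>
        simp_all [torusEnds, columnLower, columnUpper]
    · induction k using Fin.lastCases <;> induction k' using Fin.lastCases <;> cases s <;>
        cases s' <;> simp_all [torusEnds, columnUpper]
  · rintro (⟨c, d⟩ | ⟨j, b⟩)
    · fin_cases d
      · exact ⟨((c.succ, true), false), by simp [torusEnds, columnLower]⟩
      · exact ⟨((c.succ, false), false), by simp [torusEnds, columnLower]⟩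
      · exact ⟨((c.castSucc, false), true), by simp [torusEnds, columnUpper]⟩
      · exact ⟨((c.castSucc, true), true), by simp [torusEnds, columnUpper]⟩
    · cases b
      · exact ⟨((0, j), false), by simp [torusEnds, columnLower]⟩
      · exact ⟨((Fin.last _, j), true), by simp [torusEnds, columnUpper]⟩

/-- The torus link `T(2, m)` as the closure of the 2-braid with `|m|` crossings, all right-handed
if `m > 0` and all left-handed if `m < 0` (for strands that are oriented in parallel). -/
def torusLink (m : ℤ) : LinkDiagram where
  Crossing := Fin m.natAbs
  Joint := Bool
  Edge := Fin (m.natAbs + 1) × Bool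
  firstOver _ := decide (0 < m)
  ends := torusEnds m
  ends_bijective := torusEnds_bijective m

/-- Both strands of the braid are oriented upwards. -/
def torusOrientation (m : ℤ) : (torusLink m).Orientation where
  out
    | .inl (_, k) => decide (k < 2)
    | .inr (_, b) => !b
  edge := by
    rintro ⟨k, s⟩
    have h₁ : ∃ x, torusEnds m (k, s) true = x ∧
        (match x with | .inl (_, k) => decide (k < 2) | .inr (_, b) => !b) = false := by
      induction k using Fin.lastCases <;> cases s <;> simp [torusEnds, columnUpper]
    have h₂ : ∃ x, torusEnds m (k, s) false = x ∧
        (match x with | .inl (_, k) => decide (k < 2) | .inr (_, b) => !b) = true := by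
      induction k using Fin.cases <;> cases s <;> simp [torusEnds, columnLower]
    obtain ⟨_, rfl, h₁⟩ := h₁
    obtain ⟨_, rfl, h₂⟩ := h₂
    exact h₁.trans (congrArg (!·) h₂).symm
  crossing _ k := by fin_cases k <;> rfl
  joint _ := rfl

/-- The Conway polynomial `∇ₘ` of the torus link `T(2, m)`. -/
noncomputable def torusConway (m : ℤ) : ℤ[X] := (torusOrientation m).conway (0, false)

/-! ### Pretzel links -/

section Pretzel

variable {n : ℕ} [NeZero n] (p : Fin n → ℤ)

/-- The joint at the bottom (`t = false`) or at the top (`t = true`) of the column `i` on side `s`.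
The joint `(i, t)` connects the right side of the column `i` (dart `false`) with the left side of
the column `i + 1` (dart `true`), indices being cyclic. -/
def pretzelJoint (i : Fin n) (t s : Bool) : (Fin n × Bool) × Bool :=
  if s then ((i, t), false) else ((i - 1, t), true)

/-- The ends of the edges of the standard diagram of the pretzel link; the edge `⟨i, k, s⟩` lies in
the column `i` at level `k` on side `s`. -/
def pretzelEnds (e : Σ i : Fin n, Fin ((p i).natAbs + 1) × Bool) (b : Bool) :
    ((Σ i : Fin n, Fin (p i).natAbs) × Fin 4) ⊕ ((Fin n × Bool) × Bool) :=
  if b then columnUpper (fun c d => .inl (⟨e.1, c⟩, d)) (.inr (pretzelJoint e.1 true e.2.2))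
    e.2.1 e.2.2
  else columnLower (fun c d => .inl (⟨e.1, c⟩, d)) (.inr (pretzelJoint e.1 false e.2.2))
    e.2.1 e.2.2

theorem pretzelEnds_bijective :
    Function.Bijective fun x : (Σ i : Fin n, Fin ((p i).natAbs + 1) × Bool) × Bool =>
      pretzelEnds p x.1 x.2 := by
  constructor
  · rintro ⟨⟨i, k, s⟩, b⟩ ⟨⟨i', k', s'⟩, b'⟩ h
    cases b <;> cases b'
    · induction k using Fin.cases <;> induction k' using Fin.cases <;> cases s <;> cases s' <;>
        simp_all [pretzelEnds, columnLower, pretzelJoint]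
      all_goals (obtain ⟨rfl, h⟩ := h; simp_all)
    · induction k using Fin.cases <;> induction k' using Fin.lastCases <;> cases s <;> cases s' <;>
        simp_all [pretzelEnds, columnLower, columnUpper, pretzelJoint]
    · induction k using Fin.lastCases <;> induction k' using Fin.cases <;> cases s <;> cases s' <;>
        simp_all [pretzelEnds, columnLower, columnUpper, pretzelJoint]
    · induction k using Fin.lastCases <;> induction k' using Fin.lastCases <;> cases s <;>
        cases s' <;> simp_all [pretzelEnds, columnUpper, pretzelJoint]
      all_goals (obtain ⟨rfl, h⟩ := h; simp_all)
  · rintro (⟨⟨i, c⟩, d⟩ | ⟨⟨i, t⟩, b⟩)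
    · fin_cases d
      · exact ⟨(⟨i, c.succ, true⟩, false), by simp [pretzelEnds, columnLower]⟩
      · exact ⟨(⟨i, c.succ, false⟩, false), by simp [pretzelEnds, columnLower]⟩
      · exact ⟨(⟨i, c.castSucc, false⟩, true), by simp [pretzelEnds, columnUpper]⟩
      · exact ⟨(⟨i, c.castSucc, true⟩, true), by simp [pretzelEnds, columnUpper]⟩
    · cases t <;> cases b
      · exact ⟨(⟨i, 0, true⟩, false), by simp [pretzelEnds, columnLower, pretzelJoint]⟩
      · exact ⟨(⟨i + 1, 0, false⟩, false), by simp [pretzelEnds, columnLower, pretzelJoint]⟩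
      · exact ⟨(⟨i, Fin.last _, true⟩, true), by simp [pretzelEnds, columnUpper, pretzelJoint]⟩
      · exact ⟨(⟨i + 1, Fin.last _, false⟩, true), by
          simp [pretzelEnds, columnUpper, pretzelJoint]⟩

/-- The standard diagram of the `n`-pretzel link `L(p₀, …, pₙ₋₁)`: `n` vertical columns of `|pᵢ|`
crossings, the right side of each column being joined at the top and at the bottom to the left side
of the next one, and the right side of the last column to the left side of the first one. -/
def pretzelLink : LinkDiagram where
  Crossing := Σ i : Fin n, Fin (p i).natAbs
  Joint := Fin n × Bool
  Edge := Σ i : Fin n, Fin ((p i).natAbs + 1) × Bool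
  firstOver c := decide (0 < p c.1)
  ends := pretzelEnds p
  ends_bijective := pretzelEnds_bijective p

/-- The base edge: the left edge at the top of the first column. -/
def pretzelBase : (pretzelLink p).Edge := (⟨0, Fin.last _, false⟩ : Σ i : Fin n, Fin ((p i).natAbs + 1) × Bool)

variable {p}

/-- The two strands run through the column `i` in the same direction (both upwards or both
downwards). -/
def SameDirection (o : (pretzelLink p).Orientation) (i : Fin n) : Prop :=
  o.out (pretzelEnds p ⟨i, 0, false⟩ false) = o.out (pretzelEnds p ⟨i, 0, true⟩ false)

end Pretzel

/-- `m' = sign(m) (|m| - 1)`. -/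
def towardsZero (m : ℤ) : ℤ := m.sign * (|m| - 1)

/-- Polynomials in `z` as rational functions of `z`. -/
noncomputable abbrev toFrac : ℤ[X] →+* FractionRing ℤ[X] := algebraMap ℤ[X] (FractionRing ℤ[X])

/-! The polynomial is computed by Kauffman's state sum, and a pretzel diagram has very structured
states. In a column of `m > 0` crossings the `m - 1` bigons use up all crossings but one. As the top
region is beside the base edge, the spare crossing makes the column cover the bottom region (all
corners south), or the region to its west or east (a switch state: north below one crossing, south
above it). The region left of column `0` is beside the base edge too. Hence exactly one column `j`
covers the bottom region, all earlier columns cover east and all later ones west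
(`pretzel_isState_iff`). With `E i`, `S i`, `W i` the corresponding sums over the states of column
`i` alone, the state sum is the sum over `j` of `S j` times all `E i` with `i < j` and all `W i`
with `i > j` (`pretzel_stateSum`). An empty column `0` fits in: top and bottom regions coincide, and
only `j = 0` contributes.

The orientation enters only through `E`, `S`, `W`. Let z = q - q⁻¹. If the strands of a column are
parallel, its side corners have weight 1, and its north and south corners have weights x, y with x +
y = εz and xy = -1, where ε is the sign of `p i`. Then E = W = ∑ xᵏ y^(m-1-k), which is the Conway
polynomial of the torus link, and S = y^m is y times that polynomial plus the one for m'
(`parallel_column`). If the strands are antiparallel, north and south have weight 1, so S = 1, while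
E and W are sums of alternating side weights: both are -lz for 2l crossings (counted with sign), and
they are u - kz and v - kz with u + v = -z, uv = -1 for 2k + 1 (`antiparallel_even_column`,
`antiparallel_odd_column`).

Following the strands around the cycle of columns shows which columns are parallel. If all are, with
alternating directions and `n` even, the south weights y add up to half the sum of the signs times
z; this gives formulas 3 and 5. Formula 2 differs only in the first column, where S = 1 and E = W =
-lz. If all columns are odd and antiparallel, an induction on `n` shows that the state sum is a
polynomial in z of degree less than `n` with exponents of the parity of `n - 1`
(`exists_parity_polynomials`); this gives 1 and 4. -/

/-! ### States of a column of crossings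

The corners of a crossing are north (`0`), west (`1`), south (`2`) and east (`3`). -/

/-- North below the crossing `k`, the corner `d` at `k`, south above `k`. -/
def switchState {m : ℕ} (k : Fin m) (d : Fin 4) (c : Fin m) : Fin 4 :=
  if c < k then 0 else if c = k then d else 2

theorem switchState_self {m : ℕ} (k : Fin m) (d : Fin 4) : switchState k d k = d := by
  simp [switchState]

theorem eq_of_switchState_eq {m : ℕ} {k c : Fin m} {d e : Fin 4} (h : switchState k d c = e)
    (h0 : e ≠ 0) (h2 : e ≠ 2) : c = k ∧ d = e := by
  unfold switchState at h
  split_ifs at h with h1 h3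
  · exact absurd h.symm h0
  · exact ⟨h3, h⟩
  · exact absurd h.symm h2

/-- The bigons of the column are covered exactly once, and the region above it is not covered. -/
def IsColumnState {m : ℕ} (g : Fin m → Fin 4) : Prop :=
  (∀ c : Fin m, c.1 + 1 = m → g c ≠ 0) ∧ ∀ c c' : Fin m, c'.1 = c.1 + 1 → (g c ≠ 0 ↔ g c' = 2)

/-- Everything is determined by the lowest crossing that does not choose north: each bigon above it
must be covered from its upper end, so all later crossings choose south. -/
theorem isColumnState_iff {m : ℕ} (g : Fin m → Fin 4) :
    IsColumnState g ↔
      (g = fun _ => 2) ∨ ∃ k, g = switchState k 1 ∨ g = switchState k 3 := by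
  constructor
  · rintro ⟨hlast, hstep⟩
    rcases Nat.eq_zero_or_pos m with rfl | hm
    · exact Or.inl (funext fun c => c.elim0)
    have hex : ∃ k : ℕ, ∃ h : k < m, g ⟨k, h⟩ ≠ 0 :=
      ⟨m - 1, by omega, hlast _ (by simp; omega)⟩
    classical
    obtain ⟨hk, hgk⟩ := Nat.find_spec hex
    have hmin : ∀ c : Fin m, c.1 < Nat.find hex → g c = 0 := by
      intro c hc
      by_contra hne
      exact Nat.find_min hex hc ⟨c.2, hne⟩
    generalize Nat.find hex = k at hk hgk hmin
    have habove : ∀ (j : ℕ) (h : k + j + 1 < m), g ⟨k + j + 1, h⟩ = 2 := by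
      intro j
      induction j with
      | zero => exact fun h => (hstep ⟨k, hk⟩ ⟨k + 0 + 1, h⟩ rfl).1 hgk
      | succ j ih =>
        intro h
        refine (hstep ⟨k + j + 1, by omega⟩ ⟨k + (j + 1) + 1, h⟩ (by simp; omega)).1 ?_
        rw [ih (by omega)]
        decide
    have habove' : ∀ c : Fin m, k < c.1 → g c = 2 := by
      intro c hc
      have := habove (c.1 - k - 1) (by omega)
      rw [← this]
      congr 1
      ext
      simp
      omega
    have hsw : ∀ d, g ⟨k, hk⟩ = d → g = switchState ⟨k, hk⟩ d := by
      rintro d rfl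
      funext c
      unfold switchState
      split_ifs with h1 h2
      · exact hmin c h1
      · rw [h2]
      · refine habove' c ?_
        simp only [Fin.lt_def, Fin.ext_iff] at h1 h2
        omega
    have hcases : ∀ d : Fin 4, d ≠ 0 → d = 1 ∨ d = 2 ∨ d = 3 := by decide
    rcases hcases _ hgk with h | h | h
    · exact Or.inr ⟨_, Or.inl (hsw _ h)⟩
    -- A crossing that chooses south covers the bigon below it, which the crossing beneath already
    -- covers by choosing north. So there is no crossing beneath, and the whole column is south.
    · left
      rcases Nat.eq_zero_or_pos k with rfl | hpos
      · funext c
        rcases Nat.eq_zero_or_pos c.1 with h0 | h0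
        · rw [← h]; congr 1; ext; exact h0
        · exact habove' c h0
      · exact absurd (hmin ⟨k - 1, by omega⟩ (by simp; omega))
          ((hstep ⟨k - 1, by omega⟩ ⟨k, hk⟩ (by simp; omega)).2 h)
    · exact Or.inr ⟨_, Or.inr (hsw _ h)⟩
  · have key : ∀ (k : Fin m) (d : Fin 4), d ≠ 0 → d ≠ 2 → IsColumnState (switchState k d) := by
      intro k d h0 h2
      constructor
      · intro c hc
        have : ¬ c < k := by have := k.2; rw [Fin.lt_def]; omega
        unfold switchState
        rw [if_neg this]
        split_ifs
        · exact h0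
        · decide
      · intro c c' hc
        unfold switchState
        simp only [Fin.lt_def, Fin.ext_iff, hc]
        split_ifs <;> omega
    rintro (rfl | ⟨k, rfl | rfl⟩)
    · constructor <;> intros <;> simp
    · exact key k 1 (by decide) (by decide)
    · exact key k 3 (by decide) (by decide)

/-! ### Factorisation of state sums over columns -/

/-- A sum over choices in all columns that factors into sums over the columns. -/
theorem sum_ite_exists_columns {ι κ R : Type*} [Fintype ι] [Fintype κ] [DecidableEq ι]
    [CommRing R] (N : ι → ℕ) (A : κ → ∀ i, Finset (Fin (N i) → Fin 4))
    (w : (Σ i, Fin (N i)) → Fin 4 → R) (p : ((Σ i, Fin (N i)) → Fin 4) → Prop) [DecidablePred p]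
    (hp : ∀ m, p m ↔ ∃ j, ∀ i, (fun c => m ⟨i, c⟩) ∈ A j i)
    (hA : ∀ j j', j ≠ j' → ∃ i, Disjoint (A j i) (A j' i)) :
    (∑ m, if p m then ∏ c, w c (m c) else 0) =
      ∑ j, ∏ i, ∑ g ∈ A j i, ∏ c, w ⟨i, c⟩ (g c) := by
  classical
  have h1 : ∀ m : (Σ i, Fin (N i)) → Fin 4, (if p m then ∏ c, w c (m c) else 0) =
      ∑ j, ∏ i, if (fun c => m ⟨i, c⟩) ∈ A j i then ∏ c, w ⟨i, c⟩ (m ⟨i, c⟩) else 0 := by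
    intro m
    split_ifs with h
    -- By `hA` no other index is admissible for `m`, so summing over `j` counts each choice once.
    · obtain ⟨j, hj⟩ := (hp m).1 h
      rw [Finset.sum_eq_single j]
      · simp only [hj, if_true]
        exact Fintype.prod_sigma _
      · intro j' _ hne
        obtain ⟨i, hi⟩ := hA j j' hne.symm
        exact Finset.prod_eq_zero (Finset.mem_univ i)
          (if_neg (Finset.disjoint_left.1 hi (hj i)))
      · simp
    · symm
      refine Finset.sum_eq_zero fun j _ => ?_
      rw [hp] at h
      push Not at h
      obtain ⟨i, hi⟩ := h j
      exact Finset.prod_eq_zero (Finset.mem_univ i) (if_neg hi)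
  simp only [h1]
  rw [Finset.sum_comm]
  refine Finset.sum_congr rfl fun j _ => ?_
  -- Currying turns a state into a family of column states, and a sum of products over all families
  -- is a product of sums.
  rw [← Fintype.sum_equiv (Equiv.piCurry fun (i : ι) (_ : Fin (N i)) => Fin 4).symm
    (fun g => ∏ i, if g i ∈ A j i then ∏ c, w ⟨i, c⟩ (g i c) else 0) _ (fun g => rfl)]
  rw [← Fintype.prod_sum (fun i (g : Fin (N i) → Fin 4) =>
    if g ∈ A j i then ∏ c, w ⟨i, c⟩ (g c) else 0)]
  refine Finset.prod_congr rfl fun i _ => ?_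
  rw [← Finset.sum_filter]
  exact Finset.sum_congr (by ext; simp) fun _ _ => rfl

/-- The sum over the states of a column that switch at the corner `d`. -/
def switchSum {R : Type*} [CommRing R] {m : ℕ} (w : Fin m → Fin 4 → R) (d : Fin 4) : R :=
  ∑ k, ∏ c, w c (switchState k d c)

theorem sum_image_switchState {R : Type*} [CommRing R] {m : ℕ} (w : Fin m → Fin 4 → R)
    {d : Fin 4} (h0 : d ≠ 0) (h2 : d ≠ 2) :
    ∑ g ∈ Finset.univ.image fun k => switchState k d, ∏ c, w c (g c) = switchSum w d := by
  rw [Finset.sum_image]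
  · rfl
  · intro k _ k' _ h
    have := congrFun h k
    simp only [switchState_self] at this
    exact (eq_of_switchState_eq this.symm h0 h2).1

/-- The case of antiparallel strands: only the corner at the switch has a nontrivial weight. -/
theorem switchSum_of_ns_one {R : Type*} [CommRing R] {m : ℕ} {w : Fin m → Fin 4 → R} (d : Fin 4)
    (h0 : ∀ c, w c 0 = 1) (h2 : ∀ c, w c 2 = 1) : switchSum w d = ∑ k, w k d := by
  refine Finset.sum_congr rfl fun k _ => ?_
  rw [Finset.prod_eq_single k]
  · rw [switchState_self]
  · intro c _ hc
    unfold switchState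
    split_ifs
    · exact h0 c
    · exact h2 c
  · simp

/-- The case of parallel strands: a switch at height `k` leaves `k` north corners below and `m - 1 -
k` south corners above. -/
theorem switchSum_of_d_one {R : Type*} [CommRing R] {m : ℕ} {w : Fin m → Fin 4 → R} {d : Fin 4}
    {x y : R} (h0 : ∀ c, w c 0 = x) (h2 : ∀ c, w c 2 = y) (hd : ∀ c, w c d = 1) :
    switchSum w d = ∑ k ∈ Finset.range m, x ^ k * y ^ (m - 1 - k) := by
  rw [← Fin.sum_univ_eq_sum_range fun k => x ^ k * y ^ (m - 1 - k)]
  refine Finset.sum_congr rfl fun k _ => ?_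
  have h : ∀ c, w c (switchState k d c) =
      (fun c : ℕ => if c < k then x else if c = k then 1 else y) c := by
    intro c
    simp only [switchState, Fin.lt_def, Fin.ext_iff]
    split_ifs
    · exact h0 c
    · exact hd c
    · exact h2 c
  rw [Finset.prod_congr rfl fun c _ => h c,
    Fin.prod_univ_eq_prod_range (fun c : ℕ => if c < k then x else if c = k then 1 else y)]
  obtain ⟨r, hr⟩ : ∃ r, m = k.1 + 1 + r := ⟨m - (k.1 + 1), by omega⟩
  generalize k.1 = k at *
  subst hr
  rw [Finset.prod_range_add, Finset.prod_range_succ]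
  rw [Finset.prod_congr rfl (g := fun _ => x), Finset.prod_congr rfl (g := fun _ => y)
    (s₁ := Finset.range r)]
  · simp
  · intro c _
    rw [if_neg (by omega), if_neg (by omega)]
  · intro c hc
    rw [if_pos (by simpa using hc)]

/-- The bigon between the crossings `c` and `c'` is covered exactly once. -/
theorem existsUnique_cover_iff {m : ℕ} (g : Fin m → Fin 4) {c c' : Fin m} (h : c'.1 = c.1 + 1) :
    (∃! a : Fin m, (g a = 0 ∧ a.1 + 1 = c'.1) ∨ (g a = 2 ∧ a.1 = c'.1)) ↔
      (g c ≠ 0 ↔ g c' = 2) := by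
  have key : ∀ a : Fin m, ((g a = 0 ∧ a.1 + 1 = c'.1) ∨ (g a = 2 ∧ a.1 = c'.1)) ↔
      (a = c ∧ g c = 0) ∨ (a = c' ∧ g c' = 2) := by
    intro a
    constructor
    · rintro (⟨h1, h2⟩ | ⟨h1, h2⟩)
      · obtain rfl : a = c := Fin.ext (by omega)
        exact Or.inl ⟨rfl, h1⟩
      · obtain rfl : a = c' := Fin.ext h2
        exact Or.inr ⟨rfl, h1⟩
    · rintro (⟨rfl, h1⟩ | ⟨rfl, h1⟩)
      · exact Or.inl ⟨h1, h.symm⟩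
      · exact Or.inr ⟨h1, rfl⟩
  simp only [key]
  have hne : c ≠ c' := by rintro rfl; omega
  constructor
  · rintro ⟨a, ha, hu⟩
    constructor
    · intro h0
      simp_all
    · intro h2 h0
      exact hne ((hu c (Or.inl ⟨rfl, h0⟩)).trans (hu c' (Or.inr ⟨rfl, h2⟩)).symm)
  · intro hiff
    by_cases h0 : g c = 0
    · have h2 : g c' ≠ 2 := fun h2 => hiff.2 h2 h0
      exact ⟨c, Or.inl ⟨rfl, h0⟩, fun a ha => by simp_all⟩
    · have h2 := hiff.1 h0
      exact ⟨c', Or.inr ⟨rfl, h2⟩, fun a ha => by simp_all⟩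

/-! ### Regions through complete invariants -/

namespace LinkDiagram

variable {D : LinkDiagram}

theorem region_ends (e : D.Edge) (b : Bool) :
    D.region (D.ends e b) = D.region (D.prev (D.ends e (!b))) :=
  Quot.sound ⟨e, b, rfl, rfl⟩

/-- Regions are a quotient by a generated relation, so telling two of them apart requires a function
that is constant along every side of every edge. -/
theorem code_eq_of_region_eq {C : Type*} {code : D.Dart → C}
    (hcode : ∀ e b, code (D.ends e b) = code (D.prev (D.ends e (!b)))) {x y : D.Dart}
    (h : D.region x = D.region y) : code x = code y := by
  have key : ∀ x y, D.SameSide x y → code x = code y := by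
    rintro _ _ ⟨e, b, rfl, rfl⟩
    exact hcode e b
  exact congrArg (Quot.lift code key) h

/-- States in terms of a complete invariant `code` of the regions. -/
theorem isState_iff_of_code {C : Type*} {code : D.Dart → C}
    (hcode : ∀ e b, code (D.ends e b) = code (D.prev (D.ends e (!b))))
    (rep : C → D.Region) (hrep : ∀ x, rep (code x) = D.region x)
    (e : D.Edge) (m : D.Crossing → Fin 4) :
    IsState e m ↔
      (∀ c, code (.inl (c, m c)) ≠ code (D.ends e false) ∧
        code (.inl (c, m c)) ≠ code (D.ends e true)) ∧
      ∀ x, code x ≠ code (D.ends e false) → code x ≠ code (D.ends e true) →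
        ∃! c, code (.inl (c, m c)) = code x := by
  have key : ∀ x y : D.Dart, D.region x = D.region y ↔ code x = code y := fun x y =>
    ⟨code_eq_of_region_eq hcode, fun h => by rw [← hrep, ← hrep, h]⟩
  unfold IsState IsBeside
  refine and_congr (by simp only [key, not_or]) ⟨fun h x h1 h2 => ?_, fun h r => ?_⟩
  · have := h (D.region x) (by simp [key, h1, h2])
    simpa only [key] using this
  · obtain ⟨x, rfl⟩ : ∃ x, D.region x = r := Quot.exists_rep r
    intro hx
    simp only [key, not_or] at hx ⊢
    exact h x hx.1 hx.2

end LinkDiagram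

open LinkDiagram

/-! ### Regions and states of the closed 2-braid -/

section Torus

variable (m : ℤ)

theorem torusLink_ends_succ (c : Fin m.natAbs) (s : Bool) :
    (torusLink m).ends (c.succ, s) false = .inl (c, if s then 0 else 1) := rfl

theorem torusLink_ends_castSucc (c : Fin m.natAbs) (s : Bool) :
    (torusLink m).ends (c.castSucc, s) true = .inl (c, if s then 3 else 2) := by
  simp [torusLink, torusEnds, columnUpper]

theorem torusLink_ends_zero (s : Bool) :
    (torusLink m).ends (0, s) false = .inr (s, false) := rfl

theorem torusLink_ends_last (s : Bool) :
    (torusLink m).ends (Fin.last _, s) true = .inr (s, true) := by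
  simp [torusLink, torusEnds, columnUpper]

/-- The regions of the closed braid: `inl s` on side `s` of the braid, `inr k` between the two
strands at level `k`. -/
def torusCode : (Fin m.natAbs × Fin 4) ⊕ (Bool × Bool) → Bool ⊕ ℕ
  | .inl (c, d) => ![.inr (if c.1 + 1 = m.natAbs then 0 else c.1 + 1), .inl false, .inr c.1,
      .inl true] d
  | .inr (s, b) => if s = b then .inl s else .inr 0

theorem torusCode_ends (e : Fin (m.natAbs + 1) × Bool) (b : Bool) :
    torusCode m ((torusLink m).ends e b) =
      if e.2 = b then .inl e.2 else .inr (if e.1.1 = m.natAbs then 0 else e.1.1) := by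
  obtain ⟨k, s⟩ := e
  cases b
  · induction k using Fin.cases with
    | zero =>
      rw [torusLink_ends_zero]
      cases s
      · rfl
      · exact congrArg Sum.inr (ite_self 0).symm
    | succ c =>
      rw [torusLink_ends_succ]
      cases s <;> simp [torusCode]
  · induction k using Fin.lastCases with
    | last =>
      rw [torusLink_ends_last]
      cases s <;> simp [torusCode]
    | cast c =>
      rw [torusLink_ends_castSucc]
      have := c.2.ne
      cases s <;> simp [torusCode, this]

theorem torusCode_prev_ends (e : Fin (m.natAbs + 1) × Bool) (b : Bool) :
    torusCode m ((torusLink m).prev ((torusLink m).ends e b)) =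
      if e.2 = !b then .inl e.2 else .inr (if e.1.1 = m.natAbs then 0 else e.1.1) := by
  obtain ⟨k, s⟩ := e
  cases b
  · induction k using Fin.cases with
    | zero =>
      rw [torusLink_ends_zero]
      cases s
      · exact congrArg Sum.inr (ite_self 0).symm
      · rfl
    | succ c =>
      rw [torusLink_ends_succ]
      cases s <;> simp [torusCode, prev]
  · induction k using Fin.lastCases with
    | last =>
      rw [torusLink_ends_last]
      cases s <;> simp [torusCode, prev]
    | cast c =>
      rw [torusLink_ends_castSucc]
      have := c.2.ne
      cases s <;> simp [torusCode, prev, this]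

theorem torusCode_sameSide (e : (torusLink m).Edge) (b : Bool) :
    torusCode m ((torusLink m).ends e b) =
      torusCode m ((torusLink m).prev ((torusLink m).ends e (!b))) := by
  refine (torusCode_ends m e b).trans (Eq.trans ?_ (torusCode_prev_ends m e (!b)).symm)
  rw [Bool.not_not]

theorem torus_region_left (k : Fin (m.natAbs + 1)) :
    (torusLink m).region ((torusLink m).ends (k, false) false) =
      (torusLink m).region (.inr (false, false)) := by
  induction k using Fin.induction with
  | zero => rfl
  | succ c ih =>
    rw [← ih, region_ends (D := torusLink m) (c.castSucc, false) false, Bool.not_false,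
      torusLink_ends_castSucc]
    rfl

theorem torus_region_right (k : Fin (m.natAbs + 1)) :
    (torusLink m).region ((torusLink m).ends (k, true) true) =
      (torusLink m).region (.inr (true, true)) := by
  induction k using Fin.reverseInduction with
  | last => rw [torusLink_ends_last]
  | cast c ih =>
    rw [← ih, region_ends (D := torusLink m) (c.succ, true) true, torusLink_ends_castSucc]
    rfl

/-- A region for each code. -/
def torusRep : Bool ⊕ ℕ → (torusLink m).Region
  | .inl s => (torusLink m).region (.inr (s, s))
  | .inr k => if h : k < m.natAbs + 1 then
      (torusLink m).region ((torusLink m).ends (⟨k, h⟩, true) false)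
      else (torusLink m).region (.inr (true, true))

theorem torusRep_level {k : ℕ} (h : k < m.natAbs + 1) :
    torusRep m (.inr k) = (torusLink m).region ((torusLink m).ends (⟨k, h⟩, true) false) :=
  dif_pos h

theorem torus_region_south (c : Fin m.natAbs) :
    (torusLink m).region (.inl (c, 2)) =
      (torusLink m).region ((torusLink m).ends (c.castSucc, true) false) := by
  rw [region_ends (D := torusLink m) (c.castSucc, true) false, Bool.not_false,
    torusLink_ends_castSucc]
  rfl

/-- The south corner of the lowest crossing and the north corner of the highest one open into the
same region, enclosed by the closing arcs. Without crossings nothing joins the arcs, hence `hm`. -/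
theorem torus_region_last (hm : m ≠ 0) :
    (torusLink m).region ((torusLink m).ends (Fin.last _, true) false) =
      (torusLink m).region (.inr (true, false)) ∧
    (torusLink m).region (.inr (false, true)) = (torusLink m).region (.inr (true, false)) := by
  obtain ⟨r, hr⟩ : ∃ r, m.natAbs = r + 1 := ⟨m.natAbs - 1, by omega⟩
  have h1 : (torusLink m).region (.inr (false, true)) =
      (torusLink m).region (.inr (true, false)) := by
    let c : Fin m.natAbs := ⟨0, by omega⟩
    have h0 : c.castSucc = 0 := rfl
    have h2 := torus_region_south m c
    have h3 := region_ends (D := torusLink m) (c.castSucc, false) true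
    rw [torusLink_ends_castSucc] at h3
    rw [h0] at h2 h3
    exact h3.symm.trans h2
  refine ⟨?_, h1⟩
  rw [← h1]
  let c : Fin m.natAbs := ⟨r, by omega⟩
  have h0 : Fin.last _ = c.succ := by ext; simp [c, hr]
  have h3 := region_ends (D := torusLink m) (c.succ, false) true
  rw [Bool.not_true, torusLink_ends_succ, ← h0, torusLink_ends_last] at h3
  rw [h3, h0]
  rfl

theorem torusRep_torusCode (hm : m ≠ 0)
    (x : (Fin m.natAbs × Fin 4) ⊕ (Bool × Bool)) :
    torusRep m (torusCode m x) = (torusLink m).region x := by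
  obtain ⟨h1, h2⟩ := torus_region_last m hm
  rcases x with ⟨c, d⟩ | ⟨s, b⟩
  · fin_cases d
    · change torusRep m (.inr (if c.1 + 1 = m.natAbs then 0 else c.1 + 1)) = _
      split_ifs with h
      · have h0 : Fin.last _ = c.succ := by ext; simp [h]
        rw [h0] at h1
        exact h1.symm
      · exact torusRep_level m (k := c.1 + 1) (by have := c.2; omega)
    · exact (torus_region_left m c.succ).symm
    · exact (torusRep_level m (k := c.1) (by have := c.2; omega)).trans
        (torus_region_south m c).symm
    · exact (torus_region_right m c.castSucc).symm.trans
        (congrArg _ (torusLink_ends_castSucc m c true))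
  · cases s <;> cases b
    · rfl
    · exact h2.symm
    · rfl
    · rfl

theorem torusCode_crossing (c : Fin m.natAbs) (d : Fin 4) :
    (torusCode m (.inl (c, d)) = .inl false ↔ d = 1) ∧
    (torusCode m (.inl (c, d)) = .inl true ↔ d = 3) ∧
    (torusCode m (.inl (c, d)) = .inr 0 ↔ (d = 0 ∧ c.1 + 1 = m.natAbs) ∨ (d = 2 ∧ c.1 = 0)) ∧
    ∀ j, 0 < j → j < m.natAbs → (torusCode m (.inl (c, d)) = .inr j ↔
      (d = 0 ∧ c.1 + 1 = j) ∨ (d = 2 ∧ c.1 = j)) := by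
  have hc := c.2
  refine ⟨?_, ?_, ?_, fun j h1 h2 => ?_⟩ <;> fin_cases d <;> simp [torusCode]
  split_ifs <;> omega

theorem torusCode_cases (x : (Fin m.natAbs × Fin 4) ⊕ (Bool × Bool)) :
    (∃ s, torusCode m x = .inl s) ∨ torusCode m x = .inr 0 ∨
      ∃ j, 0 < j ∧ j < m.natAbs ∧ torusCode m x = .inr j := by
  rcases x with ⟨c, d⟩ | ⟨s, b⟩
  · have hc := c.2
    fin_cases d
    · by_cases h : c.1 + 1 = m.natAbs
      · simp [torusCode, h]
      · simp [torusCode, h]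
        omega
    · simp [torusCode]
    · simp [torusCode]
      omega
    · simp [torusCode]
  · unfold torusCode
    dsimp only
    split_ifs <;> simp

/-- The regions beside the base edge are the left one and the one enclosed by the closing arcs, so
the spare crossing has to cover the right region. -/
theorem torus_isState_iff (g : Fin m.natAbs → Fin 4) :
    IsState (D := torusLink m) (0, false) g ↔ ∃ k, g = switchState k 3 := by
  have e1 : torusCode m ((torusLink m).ends (0, false) false) = .inl false := by
    rw [torusCode_ends, if_pos rfl]
  have e2 : torusCode m ((torusLink m).ends (0, false) true) = .inr 0 := by
    rw [torusCode_ends, if_neg (by simp)]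
    exact congrArg Sum.inr (ite_self 0)
  -- Without crossings the code is not a complete invariant. There are then no states, since nothing
  -- can cover the region on the right, which is not beside the base edge.
  rcases eq_or_ne m 0 with rfl | hm
  · constructor
    · rintro ⟨-, h⟩
      obtain ⟨c, -⟩ := h ((torusLink 0).region (.inr (true, true))) (by
        rintro (h | h)
        · exact absurd ((code_eq_of_region_eq (torusCode_sameSide 0) h).trans e1)
            (by simp [torusCode])
        · exact absurd ((code_eq_of_region_eq (torusCode_sameSide 0) h).trans e2)
            (by simp [torusCode]))
      exact Fin.elim0 c
    · rintro ⟨k, -⟩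
      exact k.elim0
  refine (isState_iff_of_code (torusCode_sameSide m) _ (torusRep_torusCode m hm) _ _).trans ?_
  rw [e1, e2]
  change ((∀ c : Fin m.natAbs, torusCode m (.inl (c, g c)) ≠ .inl false ∧
    torusCode m (.inl (c, g c)) ≠ .inr 0) ∧ ∀ x : (Fin m.natAbs × Fin 4) ⊕ (Bool × Bool),
    torusCode m x ≠ .inl false → torusCode m x ≠ .inr 0 →
    ∃! c : Fin m.natAbs, torusCode m (.inl (c, g c)) = torusCode m x) ↔ _
  have hpos : 0 < m.natAbs := by omega
  simp only [ne_eq, (torusCode_crossing m _ _).1, (torusCode_crossing m _ _).2.2.1]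
  constructor
  · rintro ⟨h1, h2⟩
    have hg : IsColumnState g := by
      refine ⟨fun c hc h0 => (h1 c).2 (Or.inl ⟨h0, hc⟩), fun c c' hc => ?_⟩
      rw [← existsUnique_cover_iff g hc]
      have hx : torusCode m (.inl (c', 2)) = .inr c'.1 := rfl
      have h3 := h2 (.inl (c', 2)) (by simp [hx]) (by simp [hx]; omega)
      rw [hx] at h3
      simpa only [(torusCode_crossing m _ _).2.2.2 c'.1 (by omega) c'.2] using h3
    rcases (isColumnState_iff g).1 hg with rfl | ⟨k, rfl | rfl⟩
    · exact absurd (Or.inr ⟨rfl, rfl⟩) (h1 ⟨0, hpos⟩).2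
    · exact absurd (switchState_self k 1) (h1 k).1
    · exact ⟨k, rfl⟩
  · rintro ⟨k, rfl⟩
    have hg := (isColumnState_iff (switchState k 3)).2 (Or.inr ⟨k, Or.inr rfl⟩)
    refine ⟨fun c => ⟨fun h => ?_, ?_⟩, fun x hx0 hx1 => ?_⟩
    · exact absurd (eq_of_switchState_eq h (by decide) (by decide)).2 (by decide)
    · rintro (⟨h, h'⟩ | ⟨h, h'⟩)
      · exact hg.1 c h' h
      · unfold switchState at h
        simp only [Fin.lt_def, Fin.ext_iff, h'] at h
        split_ifs at h <;> omega
    · rcases torusCode_cases m x with ⟨s, hs⟩ | h0 | ⟨j, hj, hj', h⟩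
      · cases s
        · exact absurd hs hx0
        · rw [hs]
          simp only [(torusCode_crossing m _ _).2.1]
          exact ⟨k, switchState_self k 3,
            fun c hc => (eq_of_switchState_eq hc (by decide) (by decide)).1⟩
      · exact absurd h0 hx1
      · rw [h]
        simp only [(torusCode_crossing m _ _).2.2.2 j hj hj']
        exact (existsUnique_cover_iff (switchState k 3) (c := ⟨j - 1, by omega⟩) (c' := ⟨j, hj'⟩)
          (by simp; omega)).2 (hg.2 _ _ (by simp; omega))

/-- The state sum of the closed 2-braid. -/
theorem torus_stateSum (o : (torusLink m).Orientation) :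
    o.stateSum (0, false) = switchSum (fun c : Fin m.natAbs => o.weight c) 3 := by
  classical
  rw [← sum_image_switchState _ (by decide) (by decide)]
  unfold Orientation.stateSum
  rw [← Finset.sum_filter]
  refine Finset.sum_congr ?_ fun _ _ => rfl
  ext g
  rw [Finset.mem_filter]
  refine (and_iff_right (Finset.mem_univ _)).trans ((torus_isState_iff m g).trans ?_)
  refine Iff.trans ?_ Finset.mem_image.symm
  exact exists_congr fun k => ⟨fun h => ⟨Finset.mem_univ _, h.symm⟩, fun h => h.2.symm⟩

end Torus

theorem Fin.sub_one_eq_iff_val {n : ℕ} [NeZero n] (i r : Fin n) :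
    i - 1 = r ↔ i.1 = r.1 + 1 ∨ (i.1 = 0 ∧ r.1 + 1 = n) := by
  rw [sub_eq_iff_eq_add, Fin.ext_iff, Fin.val_add, Fin.val_one', Nat.add_mod_mod]
  have hi := i.2
  have hr := r.2
  rcases Nat.lt_or_ge (r.1 + 1) n with h | h
  · rw [Nat.mod_eq_of_lt h]
    omega
  · have : r.1 + 1 = n := by omega
    rw [this, Nat.mod_self]
    omega

theorem switchState_ne_two_of_val_eq_zero {m : ℕ} {k c : Fin m} {d : Fin 4} (hd : d ≠ 2)
    (hc : c.1 = 0) : switchState k d c ≠ 2 := by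
  unfold switchState
  simp only [Fin.lt_def, Fin.ext_iff (a := c)]
  split_ifs
  · decide
  · exact hd
  · omega

/-! ### Regions of the pretzel diagram -/

section Pretzel

variable {n : ℕ} [NeZero n] (p : Fin n → ℤ)

theorem pretzelLink_ends_succ (i : Fin n) (c : Fin (p i).natAbs) (s : Bool) :
    (pretzelLink p).ends ⟨i, c.succ, s⟩ false = .inl (⟨i, c⟩, if s then 0 else 1) := rfl

theorem pretzelLink_ends_castSucc (i : Fin n) (c : Fin (p i).natAbs) (s : Bool) :
    (pretzelLink p).ends ⟨i, c.castSucc, s⟩ true = .inl (⟨i, c⟩, if s then 3 else 2) := by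
  simp [pretzelLink, pretzelEnds, columnUpper]

theorem pretzelLink_ends_zero (i : Fin n) (s : Bool) :
    (pretzelLink p).ends ⟨i, 0, s⟩ false = .inr (pretzelJoint i false s) := rfl

theorem pretzelLink_ends_last (i : Fin n) (s : Bool) :
    (pretzelLink p).ends ⟨i, Fin.last _, s⟩ true = .inr (pretzelJoint i true s) := by
  simp [pretzelLink, pretzelEnds, columnUpper]

/-- The region in the column `i` at level `k`. -/
def pretzelLevel (i : Fin n) (k : ℕ) : Fin n × ℕ :=
  if k = 0 then (0, 0) else if k = (p i).natAbs then (0, (p 0).natAbs) else (i, k)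

/-- The regions of the pretzel diagram: `inl i` between the columns `i` and `i + 1`, and `inr (i, k)`
in the column `i` at level `k`; the regions below and above the columns are represented in the
column `0`. -/
def pretzelCode : ((Σ i : Fin n, Fin (p i).natAbs) × Fin 4) ⊕ ((Fin n × Bool) × Bool) →
    Fin n ⊕ (Fin n × ℕ)
  | .inl (⟨i, c⟩, d) => ![.inr (pretzelLevel p i (c + 1)), .inl (i - 1), .inr (pretzelLevel p i c),
      .inl i] d
  | .inr ((i, t), b) => if t = b then .inr (0, if t then (p 0).natAbs else 0) else .inl i

variable {p}

/-- In an empty column the bottom and top levels coincide. By `hp` this can only be column `0`,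
where the two codes agree as well. -/
theorem pretzelLevel_last (hp : ∀ i, i ≠ 0 → p i ≠ 0) (i : Fin n) :
    pretzelLevel p i (p i).natAbs = (0, (p 0).natAbs) := by
  unfold pretzelLevel
  rw [if_pos rfl]
  split_ifs with h
  · obtain rfl : i = 0 := by
      by_contra hi
      exact hp i hi (Int.natAbs_eq_zero.1 h)
    rw [h]
  · rfl

theorem pretzelCode_ends (hp : ∀ i, i ≠ 0 → p i ≠ 0) (i : Fin n) (k : Fin ((p i).natAbs + 1))
    (s b : Bool) :
    pretzelCode p ((pretzelLink p).ends ⟨i, k, s⟩ b) =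
      if s = b then .inl (if s then i else i - 1) else .inr (pretzelLevel p i k) := by
  cases b
  · induction k using Fin.cases with
    | zero =>
      rw [pretzelLink_ends_zero]
      cases s <;> simp [pretzelCode, pretzelJoint, pretzelLevel]
    | succ c =>
      rw [pretzelLink_ends_succ]
      cases s <;> simp [pretzelCode]
  · induction k using Fin.lastCases with
    | last =>
      rw [pretzelLink_ends_last]
      cases s <;> simp [pretzelCode, pretzelJoint, pretzelLevel_last hp]
    | cast c =>
      rw [pretzelLink_ends_castSucc]
      cases s <;> simp [pretzelCode]

theorem pretzelCode_prev_ends (hp : ∀ i, i ≠ 0 → p i ≠ 0) (i : Fin n)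
    (k : Fin ((p i).natAbs + 1)) (s b : Bool) :
    pretzelCode p ((pretzelLink p).prev ((pretzelLink p).ends ⟨i, k, s⟩ b)) =
      if s = !b then .inl (if s then i else i - 1) else .inr (pretzelLevel p i k) := by
  cases b
  · induction k using Fin.cases with
    | zero =>
      rw [pretzelLink_ends_zero]
      cases s <;> simp [pretzelCode, pretzelJoint, pretzelLevel, prev]
    | succ c =>
      rw [pretzelLink_ends_succ]
      cases s <;> simp [pretzelCode, prev]
  · induction k using Fin.lastCases with
    | last =>
      rw [pretzelLink_ends_last]
      cases s <;> simp [pretzelCode, pretzelJoint, pretzelLevel_last hp, prev]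
    | cast c =>
      rw [pretzelLink_ends_castSucc]
      cases s <;> simp [pretzelCode, prev]

theorem pretzelCode_sameSide (hp : ∀ i, i ≠ 0 → p i ≠ 0) (e : (pretzelLink p).Edge) (b : Bool) :
    pretzelCode p ((pretzelLink p).ends e b) =
      pretzelCode p ((pretzelLink p).prev ((pretzelLink p).ends e (!b))) := by
  obtain ⟨i, k, s⟩ := e
  refine (pretzelCode_ends hp i k s b).trans
    (Eq.trans ?_ (pretzelCode_prev_ends hp i k s (!b)).symm)
  rw [Bool.not_not]

theorem pretzel_region_left (i : Fin n) (k : Fin ((p i).natAbs + 1)) :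
    (pretzelLink p).region ((pretzelLink p).ends ⟨i, k, false⟩ false) =
      (pretzelLink p).region (.inr ((i - 1, false), true)) := by
  induction k using Fin.induction with
  | zero => rfl
  | succ c ih =>
    rw [← ih, region_ends (D := pretzelLink p) ⟨i, c.castSucc, false⟩ false, Bool.not_false,
      pretzelLink_ends_castSucc]
    rfl

theorem pretzel_region_right (i : Fin n) (k : Fin ((p i).natAbs + 1)) :
    (pretzelLink p).region ((pretzelLink p).ends ⟨i, k, true⟩ true) =
      (pretzelLink p).region (.inr ((i, true), false)) := by
  induction k using Fin.reverseInduction with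
  | last => rw [pretzelLink_ends_last]; rfl
  | cast c ih =>
    rw [← ih, region_ends (D := pretzelLink p) ⟨i, c.succ, true⟩ true, pretzelLink_ends_castSucc]
    rfl

theorem pretzel_region_between (i : Fin n) :
    (pretzelLink p).region (.inr ((i, false), true)) =
      (pretzelLink p).region (.inr ((i, true), false)) := by
  rw [← pretzel_region_right i 0, region_ends (D := pretzelLink p) ⟨i, 0, true⟩ true]
  rfl

theorem pretzel_region_south (i : Fin n) (c : Fin (p i).natAbs) :
    (pretzelLink p).region (.inl (⟨i, c⟩, 2)) =
      (pretzelLink p).region ((pretzelLink p).ends ⟨i, c.castSucc, true⟩ false) := by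
  rw [region_ends (D := pretzelLink p) ⟨i, c.castSucc, true⟩ false, Bool.not_false,
    pretzelLink_ends_castSucc]
  rfl

theorem pretzel_region_last (i : Fin n) :
    (pretzelLink p).region ((pretzelLink p).ends ⟨i, Fin.last _, true⟩ false) =
      (pretzelLink p).region (.inr ((i, true), true)) := by
  rw [region_ends (D := pretzelLink p) ⟨i, Fin.last _, true⟩ false, Bool.not_false,
    pretzelLink_ends_last]
  rfl

theorem pretzel_region_bottom_step (i : Fin n) (hi : p i ≠ 0) :
    (pretzelLink p).region (.inr ((i - 1, false), false)) =
      (pretzelLink p).region (.inr ((i, false), false)) := by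
  let c : Fin (p i).natAbs := ⟨0, by omega⟩
  have h0 : c.castSucc = 0 := rfl
  have h1 := region_ends (D := pretzelLink p) ⟨i, c.castSucc, false⟩ true
  rw [pretzelLink_ends_castSucc] at h1
  have h2 := pretzel_region_south i c
  rw [h0] at h1 h2
  exact h1.symm.trans h2

theorem pretzel_region_top_step (i : Fin n) (hi : p i ≠ 0) :
    (pretzelLink p).region (.inr ((i - 1, true), true)) =
      (pretzelLink p).region (.inr ((i, true), true)) := by
  obtain ⟨r, hr⟩ : ∃ r, (p i).natAbs = r + 1 := ⟨(p i).natAbs - 1, by omega⟩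
  let c : Fin (p i).natAbs := ⟨r, by omega⟩
  have h0 : c.succ = Fin.last _ := by ext; simp [c, hr]
  have h1 := region_ends (D := pretzelLink p) ⟨i, c.succ, false⟩ true
  rw [Bool.not_true, pretzelLink_ends_succ, h0, pretzelLink_ends_last] at h1
  refine h1.trans (Eq.trans ?_ (pretzel_region_last i))
  rw [← h0]
  rfl

/-- The induction walks from column `0` to the right, passing under the lowest or over the highest
crossing of each column it reaches. Column `0` itself is never passed, so it may be empty. -/
theorem pretzel_region_bottom_top (hp : ∀ i, i ≠ 0 → p i ≠ 0) (t : Bool) (i : Fin n) :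
    (pretzelLink p).region (.inr ((i, t), t)) = (pretzelLink p).region (.inr ((0, t), t)) := by
  obtain ⟨r, hr⟩ := i
  induction r with
  | zero => rfl
  | succ r ih =>
    have h0 : (⟨r + 1, hr⟩ : Fin n) ≠ 0 := by simp [Fin.ext_iff]
    have h1 : (⟨r + 1, hr⟩ : Fin n) - 1 = ⟨r, by omega⟩ := by simp [Fin.sub_one_eq_iff_val]
    rw [← ih (by omega), ← h1]
    cases t
    · exact (pretzel_region_bottom_step _ (hp _ h0)).symm
    · exact (pretzel_region_top_step _ (hp _ h0)).symm

variable (p) in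
/-- A region for each code. -/
def pretzelRep : Fin n ⊕ (Fin n × ℕ) → (pretzelLink p).Region
  | .inl i => (pretzelLink p).region (.inr ((i, true), false))
  | .inr (i, k) => if h : k < (p i).natAbs + 1 then
      (pretzelLink p).region ((pretzelLink p).ends ⟨i, ⟨k, h⟩, true⟩ false)
      else (pretzelLink p).region (.inr ((i, true), false))

theorem pretzelRep_inr {i : Fin n} {k : ℕ} (h : k < (p i).natAbs + 1) :
    pretzelRep p (.inr (i, k)) =
      (pretzelLink p).region ((pretzelLink p).ends ⟨i, ⟨k, h⟩, true⟩ false) :=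
  dif_pos h

theorem pretzelRep_level (hp : ∀ i, i ≠ 0 → p i ≠ 0) {i : Fin n} {k : ℕ}
    (h : k < (p i).natAbs + 1) :
    pretzelRep p (.inr (pretzelLevel p i k)) =
      (pretzelLink p).region ((pretzelLink p).ends ⟨i, ⟨k, h⟩, true⟩ false) := by
  unfold pretzelLevel
  split_ifs with h1 h2
  · subst h1
    refine (pretzelRep_inr (i := (0 : Fin n)) (k := 0) (by omega)).trans ?_
    exact (pretzel_region_bottom_top hp false i).symm
  · subst h2
    refine (pretzelRep_inr (i := 0) (k := (p 0).natAbs) (by omega)).trans ?_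
    refine (pretzel_region_last 0).trans ?_
    exact (pretzel_region_bottom_top hp true i).symm.trans (pretzel_region_last i).symm
  · exact pretzelRep_inr h

theorem pretzelRep_pretzelCode (hp : ∀ i, i ≠ 0 → p i ≠ 0)
    (x : ((Σ i : Fin n, Fin (p i).natAbs) × Fin 4) ⊕ ((Fin n × Bool) × Bool)) :
    pretzelRep p (pretzelCode p x) = (pretzelLink p).region x := by
  rcases x with ⟨⟨i, c⟩, d⟩ | ⟨⟨i, t⟩, b⟩
  · have hc := c.2
    fin_cases d
    · exact pretzelRep_level hp (k := c.1 + 1) (by omega)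
    · exact (pretzel_region_between (i - 1)).symm.trans (pretzel_region_left i c.succ).symm
    · exact (pretzelRep_level hp (k := c.1) (by omega)).trans (pretzel_region_south i c).symm
    · exact (pretzel_region_right i c.castSucc).symm.trans
        (congrArg _ (pretzelLink_ends_castSucc p i c true))
  · cases t <;> cases b
    · refine Eq.trans ?_ (pretzel_region_bottom_top hp false i).symm
      exact pretzelRep_inr (i := (0 : Fin n)) (k := 0) (by omega)
    · exact (pretzel_region_between i).symm
    · rfl
    · refine Eq.trans ?_ (pretzel_region_bottom_top hp true i).symm
      exact (pretzelRep_inr (Nat.lt_succ_self _)).trans (pretzel_region_last 0)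

theorem pretzelLevel_eq_interior {i i' : Fin n} {k j : ℕ} (h0 : 0 < j) (hj : j < (p i').natAbs) :
    pretzelLevel p i k = (i', j) ↔ i = i' ∧ k = j := by
  unfold pretzelLevel
  split_ifs with h1 h2
  · simp only [Prod.mk.injEq]
    constructor <;> rintro ⟨-, h⟩ <;> omega
  · simp only [Prod.mk.injEq]
    constructor
    · rintro ⟨rfl, rfl⟩
      exact absurd hj (lt_irrefl _)
    · rintro ⟨rfl, rfl⟩
      omega
  · simp

theorem pretzelLevel_eq_top {i : Fin n} {k : ℕ} :
    pretzelLevel p i k = (0, (p 0).natAbs) ↔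
      (k = (p i).natAbs ∧ k ≠ 0) ∨ (p 0 = 0 ∧ k = 0) := by
  unfold pretzelLevel
  split_ifs with h1 h2
  · simp only [Prod.mk.injEq, true_and]
    omega
  · simp only [true_iff]
    omega
  · simp only [Prod.mk.injEq]
    constructor
    · rintro ⟨rfl, rfl⟩
      exact absurd rfl h2
    · omega

theorem pretzelLevel_eq_bottom (h : p 0 ≠ 0) {i : Fin n} {k : ℕ} :
    pretzelLevel p i k = (0, 0) ↔ k = 0 := by
  unfold pretzelLevel
  split_ifs with h1 h2
  · simp [h1]
  · simp only [Prod.mk.injEq, true_and]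
    omega
  · simp [h1]

theorem pretzelLevel_cases (i : Fin n) {k : ℕ} (hk : k ≤ (p i).natAbs) :
    pretzelLevel p i k = (0, (p 0).natAbs) ∨ pretzelLevel p i k = (0, 0) ∨
      (0 < k ∧ k < (p i).natAbs ∧ pretzelLevel p i k = (i, k)) := by
  unfold pretzelLevel
  split_ifs with h1 h2
  · simp
  · simp
  · exact Or.inr (Or.inr ⟨by omega, by omega, rfl⟩)

theorem pretzelCode_crossing (i : Fin n) (c : Fin (p i).natAbs) (d : Fin 4) :
    (∀ r, pretzelCode p (.inl (⟨i, c⟩, d)) = .inl r ↔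
      (d = 1 ∧ (i.1 = r.1 + 1 ∨ (i.1 = 0 ∧ r.1 + 1 = n))) ∨ (d = 3 ∧ i = r)) ∧
    (pretzelCode p (.inl (⟨i, c⟩, d)) = .inr (0, (p 0).natAbs) ↔
      (d = 0 ∧ c.1 + 1 = (p i).natAbs) ∨ (p 0 = 0 ∧ d = 2 ∧ c.1 = 0)) ∧
    (p 0 ≠ 0 → (pretzelCode p (.inl (⟨i, c⟩, d)) = .inr (0, 0) ↔ d = 2 ∧ c.1 = 0)) ∧
    ∀ i' j, 0 < j → j < (p i').natAbs → (pretzelCode p (.inl (⟨i, c⟩, d)) = .inr (i', j) ↔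
      i = i' ∧ ((d = 0 ∧ c.1 + 1 = j) ∨ (d = 2 ∧ c.1 = j))) := by
  have hc := c.2
  refine ⟨fun r => ?_, ?_, fun h => ?_, fun i' j h1 h2 => ?_⟩ <;> fin_cases d <;>
    simp [pretzelCode, pretzelLevel_eq_top, pretzelLevel_eq_bottom, Fin.sub_one_eq_iff_val,
      pretzelLevel_eq_interior, *]
  omega

theorem pretzelCode_cases
    (x : ((Σ i : Fin n, Fin (p i).natAbs) × Fin 4) ⊕ ((Fin n × Bool) × Bool)) :
    (∃ r, pretzelCode p x = .inl r) ∨ pretzelCode p x = .inr (0, (p 0).natAbs) ∨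
      pretzelCode p x = .inr (0, 0) ∨
      ∃ i j, 0 < j ∧ j < (p i).natAbs ∧ pretzelCode p x = .inr (i, j) := by
  have key : ∀ (i : Fin n) (k : ℕ), k ≤ (p i).natAbs →
      pretzelCode p x = .inr (pretzelLevel p i k) → (∃ r, pretzelCode p x = .inl r) ∨
        pretzelCode p x = .inr (0, (p 0).natAbs) ∨ pretzelCode p x = .inr (0, 0) ∨
        ∃ i j, 0 < j ∧ j < (p i).natAbs ∧ pretzelCode p x = .inr (i, j) := fun i k hk hx => by
    rcases pretzelLevel_cases i hk with h | h | ⟨h1, h2, h⟩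
    · exact Or.inr (Or.inl (hx.trans (congrArg _ h)))
    · exact Or.inr (Or.inr (Or.inl (hx.trans (congrArg _ h))))
    · exact Or.inr (Or.inr (Or.inr ⟨i, k, h1, h2, hx.trans (congrArg _ h)⟩))
  rcases x with ⟨⟨i, c⟩, d⟩ | ⟨⟨i, t⟩, b⟩
  · have hc := c.2
    fin_cases d
    · exact key i (c + 1) (by omega) rfl
    · exact Or.inl ⟨_, rfl⟩
    · exact key i c (by omega) rfl
    · exact Or.inl ⟨_, rfl⟩
  · cases t <;> cases b <;> simp [pretzelCode]

variable (p) in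
/-- The states of the column `i` when the column `j` covers the region below the columns. -/
def pretzelStates (j i : Fin n) : Finset (Fin (p i).natAbs → Fin 4) :=
  if i < j then Finset.univ.image fun k => switchState k 3
  else if i = j then {fun _ => 2}
  else Finset.univ.image fun k => switchState k 1

omit [NeZero n] in
theorem pretzelStates_of_lt {j i : Fin n} (h : i < j) {g : Fin (p i).natAbs → Fin 4} :
    g ∈ pretzelStates p j i ↔ ∃ k, g = switchState k 3 := by
  simp [pretzelStates, h, eq_comm]

omit [NeZero n] in
theorem pretzelStates_self (j : Fin n) {g : Fin (p j).natAbs → Fin 4} :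
    g ∈ pretzelStates p j j ↔ g = fun _ => 2 := by
  simp [pretzelStates]

omit [NeZero n] in
theorem pretzelStates_of_gt {j i : Fin n} (h : j < i) {g : Fin (p i).natAbs → Fin 4} :
    g ∈ pretzelStates p j i ↔ ∃ k, g = switchState k 1 := by
  simp [pretzelStates, h.le.not_gt, h.ne', eq_comm]

-- At the smaller of the two indices, one family is all south and the other switches to the east.
omit [NeZero n] in
theorem pretzelStates_disjoint {j j' : Fin n} (h : j ≠ j') :
    ∃ i, Disjoint (pretzelStates p j i) (pretzelStates p j' i) := by
  have key : ∀ {j j' : Fin n}, j < j' → Disjoint (pretzelStates p j j) (pretzelStates p j' j) := by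
    intro j j' h
    rw [Finset.disjoint_left]
    intro g hg hg'
    rw [pretzelStates_self] at hg
    obtain ⟨k, hk⟩ := (pretzelStates_of_lt h).1 hg'
    have := congrFun (hg.symm.trans hk) k
    rw [switchState_self] at this
    exact absurd this (by decide)
  rcases lt_or_gt_of_ne h with h | h
  · exact ⟨j, key h⟩
  · exact ⟨j', (key h).symm⟩

/-- The conditions on a state, region by region. -/
theorem pretzel_isState_iff_code (hp : ∀ i, i ≠ 0 → p i ≠ 0)
    (m : (Σ i : Fin n, Fin (p i).natAbs) → Fin 4) :
    IsState (pretzelBase p) m ↔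
      (∀ i c, (m ⟨i, c⟩ = 1 → i ≠ 0) ∧ (m ⟨i, c⟩ = 3 → i.1 + 1 ≠ n) ∧
        (m ⟨i, c⟩ = 0 → c.1 + 1 ≠ (p i).natAbs) ∧ (p 0 = 0 → m ⟨i, c⟩ = 2 → c.1 ≠ 0)) ∧
      (∀ r : Fin n, r.1 + 1 ≠ n → ∃! c : Σ i : Fin n, Fin (p i).natAbs,
        (m c = 1 ∧ c.1.1 = r.1 + 1) ∨ (m c = 3 ∧ c.1 = r)) ∧
      (p 0 ≠ 0 → ∃! c : Σ i : Fin n, Fin (p i).natAbs, m c = 2 ∧ c.2.1 = 0) ∧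
      ∀ i, ∀ c c' : Fin (p i).natAbs, c'.1 = c.1 + 1 → (m ⟨i, c⟩ ≠ 0 ↔ m ⟨i, c'⟩ = 2) := by
  have e1 : pretzelCode p ((pretzelLink p).ends (pretzelBase p) false) = .inl (0 - 1) :=
    (pretzelCode_ends hp 0 (Fin.last _) false false).trans (if_pos rfl)
  have e2 : pretzelCode p ((pretzelLink p).ends (pretzelBase p) true) =
      .inr (0, (p 0).natAbs) :=
    ((pretzelCode_ends hp 0 (Fin.last _) false true).trans (if_neg (by simp))).trans
      (congrArg _ (pretzelLevel_last hp 0))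
  refine (isState_iff_of_code (pretzelCode_sameSide hp) _ (pretzelRep_pretzelCode hp) _ _).trans ?_
  rw [e1, e2]
  change ((∀ c : Σ i : Fin n, Fin (p i).natAbs, pretzelCode p (.inl (c, m c)) ≠ .inl (0 - 1) ∧
    pretzelCode p (.inl (c, m c)) ≠ .inr (0, (p 0).natAbs)) ∧
    ∀ x : ((Σ i : Fin n, Fin (p i).natAbs) × Fin 4) ⊕ ((Fin n × Bool) × Bool),
    pretzelCode p x ≠ .inl (0 - 1) → pretzelCode p x ≠ .inr (0, (p 0).natAbs) →
    ∃! c : Σ i : Fin n, Fin (p i).natAbs, pretzelCode p (.inl (c, m c)) = pretzelCode p x) ↔ _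
  have hlast : ∀ r : Fin n, r = 0 - 1 ↔ r.1 + 1 = n := by
    intro r
    rw [eq_comm, Fin.sub_one_eq_iff_val]
    simp
  have hR : ∀ (r : Fin n), r.1 + 1 ≠ n → ∀ c : Σ i : Fin n, Fin (p i).natAbs,
      (pretzelCode p (.inl (c, m c)) = .inl r ↔
        (m c = 1 ∧ c.1.1 = r.1 + 1) ∨ (m c = 3 ∧ c.1 = r)) := by
    rintro r hr ⟨i, c⟩
    rw [(pretzelCode_crossing i c _).1]
    simp [hr]
  -- Only crossings of the same column touch a bigon, so uniqueness among all crossings is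
  -- uniqueness within the column.
  have hI : ∀ i, ∀ c c' : Fin (p i).natAbs, c'.1 = c.1 + 1 →
      ((∃! a : Σ i : Fin n, Fin (p i).natAbs, pretzelCode p (.inl (a, m a)) = .inr (i, c'.1)) ↔
        (m ⟨i, c⟩ ≠ 0 ↔ m ⟨i, c'⟩ = 2)) := by
    intro i c c' h
    rw [← existsUnique_cover_iff (fun c => m ⟨i, c⟩) h]
    constructor
    · rintro ⟨⟨i', a⟩, ha, hu⟩
      obtain ⟨rfl, ha⟩ := ((pretzelCode_crossing i' a _).2.2.2 i c'.1 (by omega) c'.2).1 ha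
      refine ⟨a, ha, fun b hb => ?_⟩
      have := hu ⟨i', b⟩
        (((pretzelCode_crossing i' b _).2.2.2 i' c'.1 (by omega) c'.2).2 ⟨rfl, hb⟩)
      simpa using this
    · rintro ⟨a, ha, hu⟩
      refine ⟨⟨i, a⟩, ((pretzelCode_crossing i a _).2.2.2 i c'.1 (by omega) c'.2).2 ⟨rfl, ha⟩, ?_⟩
      rintro ⟨i', b⟩ hb
      obtain ⟨rfl, hb⟩ := ((pretzelCode_crossing i' b _).2.2.2 i c'.1 (by omega) c'.2).1 hb
      rw [hu b hb]
  refine and_congr ?_ ⟨fun h => ⟨fun r hr => ?_, fun h0 => ?_, fun i c c' hc => ?_⟩, ?_⟩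
  · rw [Sigma.forall]
    refine forall_congr' fun i => forall_congr' fun c => ?_
    have h1 := (pretzelCode_crossing i c (m ⟨i, c⟩)).1 (0 - 1)
    have h2 := (pretzelCode_crossing i c (m ⟨i, c⟩)).2.1
    have h3 := i.2
    have h4 := (hlast (0 - 1)).1 rfl
    have h5 : i.1 ≠ n := h3.ne
    have h6 : i = 0 ↔ i.1 = 0 := Fin.val_eq_zero_iff.symm
    rw [ne_eq, ne_eq, h1, h2, hlast, ne_eq, h4, h6]
    simp only [h5, and_true, false_or, not_or, not_and, ne_eq, and_assoc]
  · have hx : pretzelCode p (.inr ((r, true), false)) = .inl r := rfl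
    have := h (.inr ((r, true), false)) (fun h => hr ((hlast r).1 (Sum.inl.inj h)))
      (fun h => Sum.inl_ne_inr h)
    rw [hx] at this
    exact (existsUnique_congr (hR r hr)).1 this
  -- For `p 0 ≠ 0` the bottom region differs from the top one, so it is not beside the base edge and
  -- has to be covered.
  · have := h (.inr ((0, false), false)) (fun h => Sum.inr_ne_inl h) (by
      intro h
      exact h0 (Int.natAbs_eq_zero.1 (congrArg Prod.snd (Sum.inr.inj h)).symm))
    obtain ⟨c, hc, hu⟩ := this
    exact ⟨c, ((pretzelCode_crossing c.1 c.2 (m c)).2.2.1 h0).1 hc, fun b hb =>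
      hu b (((pretzelCode_crossing b.1 b.2 (m b)).2.2.1 h0).2 hb)⟩
  · rw [← hI i c c' hc]
    have hx : pretzelCode p (.inl (⟨i, c'⟩, 2)) = .inr (i, c'.1) :=
      ((pretzelCode_crossing i c' 2).2.2.2 i c'.1 (by omega) c'.2).2 ⟨rfl, Or.inr ⟨rfl, rfl⟩⟩
    have := h (.inl (⟨i, c'⟩, 2)) (by simp [hx]) (by
      rw [ne_eq, (pretzelCode_crossing i c' 2).2.1]
      simp
      omega)
    rwa [hx] at this
  · rintro ⟨h1, h2, h3⟩ x hx1 hx2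
    rcases pretzelCode_cases x with ⟨r, h⟩ | h | h | ⟨i, j, h0, hj, h⟩
    · have hr : r.1 + 1 ≠ n := by
        intro hr
        rw [← hlast] at hr
        exact hx1 (h.trans (congrArg _ hr))
      rw [h]
      simpa only [hR r hr] using h1 r hr
    · exact absurd h hx2
    · have h0 : p 0 ≠ 0 := by
        intro h0
        rw [h, h0] at hx2
        exact hx2 rfl
      obtain ⟨c, hc, hu⟩ := h2 h0
      rw [h]
      exact ⟨c, ((pretzelCode_crossing c.1 c.2 (m c)).2.2.1 h0).2 hc, fun b hb =>
        hu b (((pretzelCode_crossing b.1 b.2 (m b)).2.2.1 h0).1 hb)⟩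
    · rw [h]
      exact (hI i ⟨j - 1, by omega⟩ ⟨j, hj⟩ (by simp; omega)).2 (h3 i _ _ (by simp; omega))

end Pretzel

/-! ### States and state sum of the pretzel diagram -/

section Pretzel

variable {n : ℕ} [NeZero n] {p : Fin n → ℤ}

/-- One column covers the bottom. Column `0` cannot cover west and the last column cannot cover
east, because that region is beside the base edge. Two neighbouring columns cannot both cover the
region between them, so east propagates from the left end up to `j` and west from the right end down
to `j`. -/
theorem pretzel_exists_states_of_isState (hp : ∀ i, i ≠ 0 → p i ≠ 0)
    (m : (Σ i : Fin n, Fin (p i).natAbs) → Fin 4) (hm : IsState (pretzelBase p) m) :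
    ∃ j, ∀ i, (fun c => m ⟨i, c⟩) ∈ pretzelStates p j i := by
  obtain ⟨h1, h2, h3, h4⟩ := (pretzel_isState_iff_code hp m).1 hm
  have hcol : ∀ i, IsColumnState fun c => m ⟨i, c⟩ := fun i =>
    ⟨fun c hc h0 => (h1 i c).2.2.1 h0 hc, h4 i⟩
  have htype := fun i => (isColumnState_iff _).1 (hcol i)
  -- If `p 0 = 0`, the bottom region is beside the base edge and must stay uncovered; the empty
  -- column `0` then vacuously plays the role of the all-south column.
  have hS : ∃ j, ∀ i, ((fun c : Fin (p i).natAbs => m ⟨i, c⟩) = fun _ => 2) ↔ i = j := by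
    by_cases h0 : p 0 = 0
    · refine ⟨0, fun i => ⟨fun h => ?_, ?_⟩⟩
      · by_contra hi
        have hpi := hp i hi
        exact (h1 i ⟨0, by omega⟩).2.2.2 h0 (congrFun h _) rfl
      · rintro rfl
        funext c
        exact absurd c.2 (by simp [h0])
    · obtain ⟨⟨j, c⟩, ⟨hc1, hc2⟩, hu⟩ := h3 h0
      refine ⟨j, fun i => ⟨fun h => ?_, ?_⟩⟩
      · have hpi : p i ≠ 0 := by
          by_cases hi : i = 0
          · rwa [hi]
          · exact hp i hi
        exact congrArg Sigma.fst (hu ⟨i, ⟨0, by omega⟩⟩ ⟨congrFun h _, rfl⟩)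
      · rintro rfl
        rcases htype i with h | ⟨k, h | h⟩
        · exact h
        · exact absurd ((congrFun h c).symm.trans hc1)
            (switchState_ne_two_of_val_eq_zero (by decide) hc2)
        · exact absurd ((congrFun h c).symm.trans hc1)
            (switchState_ne_two_of_val_eq_zero (by decide) hc2)
  obtain ⟨j, hj⟩ := hS
  have htype' : ∀ i, i ≠ j → (∃ k, m ⟨i, k⟩ = 1 ∧ (fun c => m ⟨i, c⟩) = switchState k 1) ∨
      ∃ k, m ⟨i, k⟩ = 3 ∧ (fun c => m ⟨i, c⟩) = switchState k 3 := by
    intro i hi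
    rcases htype i with h | ⟨k, h | h⟩
    · exact absurd ((hj i).1 h) hi
    · exact Or.inl ⟨k, (congrFun h k).trans (switchState_self k 1), h⟩
    · exact Or.inr ⟨k, (congrFun h k).trans (switchState_self k 3), h⟩
  have hnot : ∀ (r : ℕ) (hr : r + 1 < n) (k : Fin (p ⟨r, by omega⟩).natAbs)
      (k' : Fin (p ⟨r + 1, hr⟩).natAbs), m ⟨⟨r, by omega⟩, k⟩ = 3 →
      m ⟨⟨r + 1, hr⟩, k'⟩ = 1 → False := by
    intro r hr k k' h h'
    have := (h2 ⟨r, by omega⟩ (by simp; omega)).unique (Or.inr ⟨h, rfl⟩) (Or.inl ⟨h', rfl⟩)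
    have := congrArg (fun c => c.1.1) this
    simp at this
  have hlt : ∀ (r : ℕ) (hr : r < n), r < j.1 →
      ∃ k, m ⟨⟨r, hr⟩, k⟩ = 3 ∧ (fun c => m ⟨⟨r, hr⟩, c⟩) = switchState k 3 := by
    intro r
    induction r with
    | zero =>
      intro hr hlt
      refine (htype' ⟨0, hr⟩ (by rw [ne_eq, Fin.ext_iff]; simp; omega)).resolve_left ?_
      rintro ⟨k, hk, -⟩
      exact (h1 _ k).1 hk rfl
    | succ r ih =>
      intro hr hlt
      refine (htype' ⟨r + 1, hr⟩ (by rw [ne_eq, Fin.ext_iff]; simp; omega)).resolve_left ?_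
      rintro ⟨k, hk, -⟩
      obtain ⟨k', hk', -⟩ := ih (by omega) (by omega)
      exact hnot r hr k' k hk' hk
  have hgt : ∀ (s r : ℕ) (hr : r < n), r + s + 1 = n → j.1 < r →
      ∃ k, m ⟨⟨r, hr⟩, k⟩ = 1 ∧ (fun c => m ⟨⟨r, hr⟩, c⟩) = switchState k 1 := by
    intro s
    induction s with
    | zero =>
      intro r hr hs hlt
      refine (htype' ⟨r, hr⟩ (by rw [ne_eq, Fin.ext_iff]; simp; omega)).resolve_right ?_
      rintro ⟨k, hk, -⟩
      exact (h1 _ k).2.1 hk hs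
    | succ s ih =>
      intro r hr hs hlt
      refine (htype' ⟨r, hr⟩ (by rw [ne_eq, Fin.ext_iff]; simp; omega)).resolve_right ?_
      rintro ⟨k, hk, -⟩
      obtain ⟨k', hk', -⟩ := ih (r + 1) (by omega) (by omega) (by omega)
      exact hnot r (by omega) k k' hk hk'
  refine ⟨j, fun i => ?_⟩
  rcases lt_trichotomy i j with h | rfl | h
  · rw [pretzelStates_of_lt h]
    exact (hlt i.1 i.2 h).imp fun k hk => hk.2
  · rw [pretzelStates_self]
    exact (hj i).2 rfl
  · rw [pretzelStates_of_gt h]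
    exact (hgt (n - 1 - i.1) i.1 i.2 (by omega) h).imp fun k hk => hk.2

theorem pretzel_isState_of_states (hp : ∀ i, i ≠ 0 → p i ≠ 0)
    (m : (Σ i : Fin n, Fin (p i).natAbs) → Fin 4) (j : Fin n)
    (hm : ∀ i, (fun c => m ⟨i, c⟩) ∈ pretzelStates p j i) : IsState (pretzelBase p) m := by
  have hlt : ∀ i, i < j → ∃ k, (fun c => m ⟨i, c⟩) = switchState k 3 := fun i hi =>
    (pretzelStates_of_lt hi).1 (hm i)
  have hgt : ∀ i, j < i → ∃ k, (fun c => m ⟨i, c⟩) = switchState k 1 := fun i hi =>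
    (pretzelStates_of_gt hi).1 (hm i)
  have hself : ∀ c, m ⟨j, c⟩ = 2 := congrFun ((pretzelStates_self j).1 (hm j))
  have h3 : ∀ i c, m ⟨i, c⟩ = 3 → i < j := by
    intro i c hc
    rcases lt_trichotomy i j with h | rfl | h
    · exact h
    · rw [hself] at hc
      exact absurd hc (by decide)
    · obtain ⟨k, hk⟩ := hgt i h
      exact absurd (eq_of_switchState_eq ((congrFun hk c).symm.trans hc) (by decide)
        (by decide)).2 (by decide)
  have h1 : ∀ i c, m ⟨i, c⟩ = 1 → j < i := by
    intro i c hc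
    rcases lt_trichotomy i j with h | rfl | h
    · obtain ⟨k, hk⟩ := hlt i h
      exact absurd (eq_of_switchState_eq ((congrFun hk c).symm.trans hc) (by decide)
        (by decide)).2 (by decide)
    · rw [hself] at hc
      exact absurd hc (by decide)
    · exact h
  have h2 : ∀ i c, m ⟨i, c⟩ = 2 → c.1 = 0 → i = j := by
    intro i c hc h0
    rcases lt_trichotomy i j with h | h | h
    · obtain ⟨k, hk⟩ := hlt i h
      exact absurd ((congrFun hk c).symm.trans hc)
        (switchState_ne_two_of_val_eq_zero (by decide) h0)
    · exact h
    · obtain ⟨k, hk⟩ := hgt i h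
      exact absurd ((congrFun hk c).symm.trans hc)
        (switchState_ne_two_of_val_eq_zero (by decide) h0)
  have hcol : ∀ i, IsColumnState fun c => m ⟨i, c⟩ := by
    intro i
    rw [isColumnState_iff]
    rcases lt_trichotomy i j with h | rfl | h
    · exact Or.inr ((hlt i h).imp fun k hk => Or.inr hk)
    · exact Or.inl (funext hself)
    · exact Or.inr ((hgt i h).imp fun k hk => Or.inl hk)
  rw [pretzel_isState_iff_code hp]
  refine ⟨fun i c => ⟨fun hc h0 => ?_, fun hc h0 => ?_, fun hc h0 => (hcol i).1 c h0 hc,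
    fun hp0 hc h0 => ?_⟩, fun r hr => ?_, fun hp0 => ?_, fun i => (hcol i).2⟩
  · subst h0
    exact absurd (h1 _ c hc) (Fin.not_lt_zero j)
  · have := h3 i c hc
    have := j.2
    omega
  · obtain rfl := h2 i c hc h0
    have hi : i ≠ 0 := by
      rintro rfl
      have := c.2
      omega
    -- An empty column `0` forces `j = 0`: every column before `j` switches at some crossing, and
    -- column `0` has none.
    obtain ⟨k, -⟩ := hlt 0 (Fin.pos_iff_ne_zero.2 hi)
    have := k.2
    omega
  -- The region to the right of column `r` is covered by column `r` if `r < j`, and by column `r +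
  -- 1` otherwise.
  · rcases lt_or_ge r j with h | h
    · obtain ⟨k, hk⟩ := hlt r h
      refine ⟨⟨r, k⟩, Or.inr ⟨(congrFun hk k).trans (switchState_self k 3), rfl⟩, ?_⟩
      rintro ⟨i, c⟩ (⟨hc, hi⟩ | ⟨hc, hi⟩)
      · have := h1 i c hc
        simp only at hi
        omega
      · obtain rfl : i = r := hi
        rw [(eq_of_switchState_eq ((congrFun hk c).symm.trans hc) (by decide) (by decide)).1]
    · have hr' : r.1 + 1 < n := by omega
      obtain ⟨k, hk⟩ := hgt ⟨r.1 + 1, hr'⟩ (by rw [Fin.lt_def]; simp; omega)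
      refine ⟨⟨_, k⟩, Or.inl ⟨(congrFun hk k).trans (switchState_self k 1), rfl⟩, ?_⟩
      rintro ⟨i, c⟩ (⟨hc, hi⟩ | ⟨hc, hi⟩)
      · obtain rfl : i = ⟨r.1 + 1, hr'⟩ := Fin.ext hi
        rw [(eq_of_switchState_eq ((congrFun hk c).symm.trans hc) (by decide) (by decide)).1]
      · have := h3 i c hc
        obtain rfl : i = r := hi
        omega
  · have hpj : p j ≠ 0 := by
      by_cases hj : j = 0
      · rwa [hj]
      · exact hp j hj
    refine ⟨⟨j, ⟨0, by omega⟩⟩, ⟨hself _, rfl⟩, ?_⟩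
    rintro ⟨i, c⟩ ⟨hc, h0⟩
    obtain rfl := h2 i c hc h0
    congr 1
    exact Fin.ext h0

theorem pretzel_isState_iff (hp : ∀ i, i ≠ 0 → p i ≠ 0)
    (m : (Σ i : Fin n, Fin (p i).natAbs) → Fin 4) :
    IsState (pretzelBase p) m ↔ ∃ j, ∀ i, (fun c => m ⟨i, c⟩) ∈ pretzelStates p j i :=
  ⟨pretzel_exists_states_of_isState hp m, fun ⟨j, hj⟩ => pretzel_isState_of_states hp m j hj⟩

/-- The weight of the corner `d` of the crossing `c` of the column `i`. -/
noncomputable def pretzelWeight (o : (pretzelLink p).Orientation) (i : Fin n)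
    (c : Fin (p i).natAbs) (d : Fin 4) : ℤ[T;T⁻¹] :=
  o.weight (⟨i, c⟩ : Σ i : Fin n, Fin (p i).natAbs) d

/-- The state sum of a pretzel link. -/
theorem pretzel_stateSum (hp : ∀ i, i ≠ 0 → p i ≠ 0) (o : (pretzelLink p).Orientation) :
    o.stateSum (pretzelBase p) = ∑ j, ∏ i, if i < j then switchSum (pretzelWeight o i) 3
      else if i = j then ∏ c, pretzelWeight o i c 2 else switchSum (pretzelWeight o i) 1 := by
  classical
  refine Eq.trans ?_ ((sum_ite_exists_columns (fun i => (p i).natAbs) (pretzelStates p)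
    (fun c => o.weight c) (fun m => IsState (pretzelBase p) m) (pretzel_isState_iff hp)
    (fun _ _ => pretzelStates_disjoint)).trans ?_)
  · unfold Orientation.stateSum
    refine Finset.sum_congr ?_ fun m _ => ?_
    · ext; exact ⟨fun _ => Finset.mem_univ _, fun _ => Finset.mem_univ _⟩
    · split_ifs
      · rfl
      · rfl
  · refine Finset.sum_congr rfl fun j _ => Finset.prod_congr rfl fun i _ => ?_
    unfold pretzelStates
    split_ifs
    · exact sum_image_switchState (pretzelWeight o i) (by decide) (by decide)
    · exact Finset.sum_singleton _ _
    · exact sum_image_switchState (pretzelWeight o i) (by decide) (by decide)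

end Pretzel

/-! ### The Conway polynomials of the torus links -/

/-- The variable `z = q - q⁻¹` of the Conway polynomial. -/
noncomputable abbrev conwayVar : ℤ[T;T⁻¹] := LaurentPolynomial.T 1 - LaurentPolynomial.T (-1)

/-- Every real z has the form t - t⁻¹ with t a root of t² - zt - 1, so a polynomial killed by
`conwayVar` vanishes at all reals. This identifies the polynomial selected by choice in
`Orientation.conway`. -/
theorem aeval_conwayVar_injective :
    Function.Injective (Polynomial.aeval conwayVar : ℤ[X] → ℤ[T;T⁻¹]) := by
  rw [injective_iff_map_eq_zero]
  intro P hP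
  have key : ∀ z : ℝ, (P.map (Int.castRingHom ℝ)).eval z = 0 := by
    intro z
    set t : ℝ := (z + √(z ^ 2 + 4)) / 2 with ht
    have hs : √(z ^ 2 + 4) * √(z ^ 2 + 4) = z ^ 2 + 4 := Real.mul_self_sqrt (by positivity)
    have h1 : t * (t - z) = 1 := by
      rw [ht]
      linear_combination hs / 4
    let w : ℝˣ := ⟨t, t - z, h1, by rw [mul_comm, h1]⟩
    have h2 := congrArg (LaurentPolynomial.eval₂ (Int.castRingHom ℝ) w) hP
    rw [map_zero, Polynomial.aeval_def, Polynomial.hom_eval₂] at h2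
    have h3 : LaurentPolynomial.eval₂ (Int.castRingHom ℝ) w conwayVar = z := by
      rw [map_sub, LaurentPolynomial.eval₂_T, LaurentPolynomial.eval₂_T]
      simp [w]
    rw [h3, RingHom.eq_intCast' (RingHom.comp _ _)] at h2
    rw [Polynomial.eval_map]
    exact h2
  have h0 : P.map (Int.castRingHom ℝ) = 0 := Polynomial.funext fun z => by simp [key z]
  exact (Polynomial.map_eq_zero_iff (Int.castRingHom ℝ).injective_int).1 h0

/-- The Conway polynomial of `T(2, ε k)`, where `ε = ±1`, by recursion. -/
noncomputable def torusPolynomial (ε : ℤ) : ℕ → ℤ[X]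
  | 0 => 0
  | 1 => 1
  | k + 2 => Polynomial.C ε * Polynomial.X * torusPolynomial ε (k + 1) + torusPolynomial ε k

section GeomSum

variable {R : Type*} [CommRing R] {x y : R}

/-- The sums on the right satisfy the linear recurrence with characteristic roots `x` and `y`, whose
coefficients are `x + y` and `-x * y`. -/
theorem aeval_torusPolynomial {z : R} {ε : ℤ} (hadd : x + y = ε * z) (hmul : x * y = -1) (k : ℕ) :
    Polynomial.aeval z (torusPolynomial ε k) =
      ∑ i ∈ Finset.range k, x ^ i * y ^ (k - 1 - i) := by
  induction k using Nat.twoStepInduction with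
  | zero => simp [torusPolynomial]
  | one => simp [torusPolynomial]
  | more k ih0 ih1 =>
    simp only [torusPolynomial, map_add, map_mul, Polynomial.aeval_X, ih0, ih1,
      eq_intCast, map_intCast]
    have h1 := geom_sum₂_succ_eq (x := x) (y := y) (n := k)
    have h2 := geom_sum₂_succ_eq (x := x) (y := y) (n := k + 1)
    simp only [Nat.add_sub_cancel, show k + 2 - 1 = k + 1 from rfl] at h1 h2 ⊢
    rw [h2, ← hadd]
    linear_combination x * h1 + (∑ i ∈ Finset.range k, x ^ i * y ^ (k - 1 - i)) * hmul

/-- Writing s for the sums of `aeval_torusPolynomial`, multiply s_k = x^(k-1) + y s_(k-1) by `x` and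
use `x * y = -1`. -/
theorem pow_eq_aeval_torusPolynomial {z : R} {ε : ℤ} (hadd : x + y = ε * z) (hmul : x * y = -1)
    {k : ℕ} (hk : k ≠ 0) :
    x ^ k = x * Polynomial.aeval z (torusPolynomial ε k) +
      Polynomial.aeval z (torusPolynomial ε (k - 1)) := by
  obtain ⟨k, rfl⟩ := Nat.exists_eq_succ_of_ne_zero hk
  rw [aeval_torusPolynomial hadd hmul, aeval_torusPolynomial hadd hmul]
  have h1 := geom_sum₂_succ_eq (x := x) (y := y) (n := k)
  simp only [Nat.succ_eq_add_one, Nat.add_sub_cancel] at h1 ⊢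
  linear_combination -x * h1 - (∑ i ∈ Finset.range k, x ^ i * y ^ (k - 1 - i)) * hmul

end GeomSum

/-- The value at z = 0 is 1. This permits division in the rational formulas. -/
theorem torusPolynomial_ne_zero_of_odd (ε : ℤ) {k : ℕ} (hk : Odd k) : torusPolynomial ε k ≠ 0 := by
  obtain ⟨r, rfl⟩ := hk
  have h : (torusPolynomial ε (2 * r + 1)).eval 0 = 1 := by
    induction r with
    | zero => simp [torusPolynomial]
    | succ r ih =>
      rw [show 2 * (r + 1) + 1 = 2 * r + 1 + 2 by ring, torusPolynomial]
      simpa using ih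
  intro h0
  rw [h0] at h
  simp at h

theorem LaurentPolynomial.T_mul_neg_T_neg (ε : ℤ) :
    (LaurentPolynomial.T ε : ℤ[T;T⁻¹]) * -LaurentPolynomial.T (-ε) = -1 := by
  rw [mul_neg, ← LaurentPolynomial.T_add, add_neg_cancel, LaurentPolynomial.T_zero]

theorem LaurentPolynomial.T_add_neg_T_neg {ε : ℤ} (hε : ε = 1 ∨ ε = -1) :
    (LaurentPolynomial.T ε : ℤ[T;T⁻¹]) + -LaurentPolynomial.T (-ε) = (ε : ℤ[T;T⁻¹]) * conwayVar := by
  rcases hε with rfl | rfl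
  · push_cast
    ring
  · rw [neg_neg]
    push_cast
    ring

theorem Int.sign_eq_one_or_neg_one {m : ℤ} (hm : m ≠ 0) : m.sign = 1 ∨ m.sign = -1 := by
  rcases lt_or_gt_of_ne hm with h | h
  · exact Or.inr (Int.sign_eq_neg_one_of_neg h)
  · exact Or.inl (Int.sign_eq_one_of_pos h)

/-! ### Corner weights at parallel and antiparallel crossings -/

namespace LinkDiagram.Orientation

variable {D : LinkDiagram} (o : D.Orientation) (c : D.Crossing) {a : Bool}

theorem crossingSign_of_parallel (h0 : o.out (.inl (c, 0)) = a) (h1 : o.out (.inl (c, 1)) = a) :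
    o.crossingSign c = if D.firstOver c = true then 1 else -1 := by
  simp [crossingSign, h0, h1]

theorem crossingSign_of_antiparallel (h0 : o.out (.inl (c, 0)) = a)
    (h1 : o.out (.inl (c, 1)) = !a) :
    o.crossingSign c = if D.firstOver c = true then -1 else 1 := by
  cases h : D.firstOver c <;> simp [crossingSign, h0, h1, h]

theorem weight_of_parallel (h0 : o.out (.inl (c, 0)) = a) (h1 : o.out (.inl (c, 1)) = a) :
    o.weight c 0 = (if a then LaurentPolynomial.T (o.crossingSign c)
      else -LaurentPolynomial.T (-o.crossingSign c)) ∧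
    o.weight c 1 = 1 ∧
    o.weight c 2 = (if a then -LaurentPolynomial.T (-o.crossingSign c)
      else LaurentPolynomial.T (o.crossingSign c)) ∧
    o.weight c 3 = 1 := by
  have h2 : o.out (.inl (c, 2)) = !a := (o.crossing c 0).trans (by rw [h0])
  have h3 : o.out (.inl (c, 3)) = !a := (o.crossing c 1).trans (by rw [h1])
  cases a <;> simp [weight, h0, h1, h2, h3]

theorem weight_of_antiparallel (h0 : o.out (.inl (c, 0)) = a) (h1 : o.out (.inl (c, 1)) = !a) :
    o.weight c 0 = 1 ∧
    o.weight c 1 = (if a then -LaurentPolynomial.T (-o.crossingSign c)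
      else LaurentPolynomial.T (o.crossingSign c)) ∧
    o.weight c 2 = 1 ∧
    o.weight c 3 = (if a then LaurentPolynomial.T (o.crossingSign c)
      else -LaurentPolynomial.T (-o.crossingSign c)) := by
  have h2 : o.out (.inl (c, 2)) = !a := (o.crossing c 0).trans (by rw [h0])
  have h3 : o.out (.inl (c, 3)) = a := (o.crossing c 1).trans (by rw [h1, Bool.not_not])
  cases a <;> simp [weight, h0, h1, h2, h3]

end LinkDiagram.Orientation

theorem if_pos_eq_sign {m : ℤ} (hm : m ≠ 0) :
    (if decide (0 < m) = true then (1 : ℤ) else -1) = m.sign := by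
  rcases lt_or_gt_of_ne hm with h | h
  · rw [Int.sign_eq_neg_one_of_neg h]
    simp [h.le]
  · rw [Int.sign_eq_one_of_pos h]
    simp [h]

theorem torus_hasConwayPolynomial (m : ℤ) :
    (torusOrientation m).HasConwayPolynomial (0, false) (torusPolynomial m.sign m.natAbs) := by
  unfold Orientation.HasConwayPolynomial
  rw [torus_stateSum]
  rcases eq_or_ne m 0 with rfl | hm
  · simp [torusPolynomial, switchSum]
  refine (aeval_torusPolynomial
    (LaurentPolynomial.T_add_neg_T_neg (Int.sign_eq_one_or_neg_one hm))
    (LaurentPolynomial.T_mul_neg_T_neg m.sign) _).trans ?_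
  have hs : ∀ c : Fin m.natAbs, (torusOrientation m).crossingSign c = m.sign := fun c =>
    ((torusOrientation m).crossingSign_of_parallel (a := true) c rfl rfl).trans (if_pos_eq_sign hm)
  have hw := fun c : Fin m.natAbs => (torusOrientation m).weight_of_parallel (a := true) c rfl rfl
  refine (switchSum_of_d_one (fun c => ?_) (fun c => ?_) (fun c => (hw c).2.2.2)).symm
  · rw [(hw c).1, hs, if_pos rfl]
  · rw [(hw c).2.2.1, hs, if_pos rfl]

theorem torusConway_eq (m : ℤ) : torusConway m = torusPolynomial m.sign m.natAbs := by
  have h : ∃ P, (torusOrientation m).HasConwayPolynomial (0, false) P :=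
    ⟨_, torus_hasConwayPolynomial m⟩
  unfold torusConway Orientation.conway
  rw [dif_pos h]
  exact aeval_conwayVar_injective (h.choose_spec.trans (torus_hasConwayPolynomial m).symm)

theorem torusConway_ne_zero_of_odd {m : ℤ} (hm : Odd m) : torusConway m ≠ 0 := by
  rw [torusConway_eq]
  exact torusPolynomial_ne_zero_of_odd _ (Int.natAbs_odd.2 hm)

theorem torusConway_towardsZero {m : ℤ} (hm : m ≠ 0) :
    torusConway (towardsZero m) = torusPolynomial m.sign (m.natAbs - 1) := by
  rw [torusConway_eq]
  have h1 : towardsZero m = m.sign * ((m.natAbs - 1 : ℕ) : ℤ) := by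
    unfold towardsZero
    rw [Nat.cast_sub (by omega)]
    simp
  have h2 : (towardsZero m).natAbs = m.natAbs - 1 := by
    rw [h1, Int.natAbs_mul, Int.natAbs_sign_of_ne_zero hm, one_mul, Int.natAbs_natCast]
  rw [h2]
  rcases Nat.eq_zero_or_pos (m.natAbs - 1) with h | h
  -- Here `towardsZero m` has sign 0 rather than the sign of `m`, which is harmless as
  -- `torusPolynomial` at 0 ignores its sign.
  · rw [h]; rfl
  · rw [h1, Int.sign_mul, Int.sign_sign, Int.sign_eq_one_of_pos (a := ((m.natAbs - 1 : ℕ) : ℤ))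
      (by exact_mod_cast h), mul_one]

/-! ### Orientations of the columns of a pretzel link -/

theorem Finset.sum_range_ite_even {R : Type*} [CommRing R] (f g : R) (h : ℕ) :
    ∑ k ∈ Finset.range (2 * h), (if Even k then f else g) = h * (f + g) := by
  induction h with
  | zero => simp
  | succ h ih =>
    rw [show 2 * (h + 1) = 2 * h + 1 + 1 by ring, Finset.sum_range_succ, Finset.sum_range_succ, ih,
      if_pos (even_two_mul h), if_neg (by simp)]
    push_cast
    ring

section Pretzel

variable {n : ℕ} [NeZero n] {p : Fin n → ℤ} (o : (pretzelLink p).Orientation)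

/-- The edge at level `k` on side `s` of the column `i` is directed upwards. -/
def edgeUp (i : Fin n) (k : Fin ((p i).natAbs + 1)) (s : Bool) : Bool :=
  o.out ((pretzelLink p).ends ⟨i, k, s⟩ false)

theorem out_ends_true (i : Fin n) (k : Fin ((p i).natAbs + 1)) (s : Bool) :
    o.out ((pretzelLink p).ends ⟨i, k, s⟩ true) = !edgeUp o i k s :=
  o.edge _

theorem edgeUp_castSucc (i : Fin n) (c : Fin (p i).natAbs) (s : Bool) :
    edgeUp o i c.castSucc s = edgeUp o i c.succ (!s) := by
  have h1 := out_ends_true o i c.castSucc s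
  rw [pretzelLink_ends_castSucc] at h1
  have h2 := o.crossing (⟨i, c⟩ : Σ i : Fin n, Fin (p i).natAbs) (if s then 1 else 0)
  have h3 : edgeUp o i c.succ (!s) = o.out (.inl ((⟨i, c⟩ : Σ i : Fin n, Fin (p i).natAbs),
      if s then 1 else 0)) := by
    cases s <;> rfl
  rw [h3]
  apply Bool.not_inj
  refine h1.symm.trans (Eq.trans ?_ h2)
  cases s <;> rfl

theorem edgeUp_eq (i : Fin n) (k : Fin ((p i).natAbs + 1)) (s : Bool) :
    edgeUp o i k s = if Even k.1 then edgeUp o i 0 s else edgeUp o i 0 (!s) := by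
  induction k using Fin.induction generalizing s with
  | zero => simp
  | succ c ih =>
    have h := edgeUp_castSucc o i c (!s)
    rw [Bool.not_not] at h
    rw [← h, ih, Bool.not_not]
    simp only [Fin.val_castSucc, Fin.val_succ, Nat.even_add_one]
    split_ifs <;> rfl

theorem edgeUp_zero_false (i : Fin n) : edgeUp o i 0 false = !edgeUp o (i - 1) 0 true :=
  o.joint (i - 1, false)

theorem edgeUp_last_false (i : Fin n) :
    edgeUp o i (Fin.last _) false = !edgeUp o (i - 1) (Fin.last _) true := by
  have h1 := out_ends_true o i (Fin.last _) false
  have h2 := out_ends_true o (i - 1) (Fin.last _) true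
  rw [pretzelLink_ends_last] at h1 h2
  have h3 : o.out (.inr ((i - 1, true), true)) = !o.out (.inr ((i - 1, true), false)) :=
    o.joint (i - 1, true)
  apply Bool.not_inj
  exact h1.symm.trans (h3.trans (congrArg _ h2))

theorem edgeUp_last_of_odd {i : Fin n} (hi : Odd (p i)) (s : Bool) :
    edgeUp o i (Fin.last _) s = edgeUp o i 0 (!s) := by
  rw [edgeUp_eq, if_neg]
  rw [Fin.val_last, Nat.not_even_iff_odd, Int.natAbs_odd]
  exact hi

theorem edgeUp_last_of_even {i : Fin n} (hi : Even (p i)) (s : Bool) :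
    edgeUp o i (Fin.last _) s = edgeUp o i 0 s := by
  rw [edgeUp_eq, if_pos]
  rw [Fin.val_last, Int.natAbs_even]
  exact hi

theorem firstOver_pretzelLink (i : Fin n) (c : Fin (p i).natAbs) :
    (pretzelLink p).firstOver (⟨i, c⟩ : Σ i : Fin n, Fin (p i).natAbs) = decide (0 < p i) := rfl

/-- The sum of a column with parallel strands over the states that cover the region to the east
or to the west, and the weight of the state that covers the region to the south. -/
theorem parallel_column {i : Fin n} (hi : p i ≠ 0) {a : Bool} (h0 : edgeUp o i 0 false = a)
    (h1 : edgeUp o i 0 true = a) :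
    switchSum (pretzelWeight o i) 3 = Polynomial.aeval conwayVar (torusConway (p i)) ∧
    switchSum (pretzelWeight o i) 1 = Polynomial.aeval conwayVar (torusConway (p i)) ∧
    ∏ c, pretzelWeight o i c 2 =
      (if a then -LaurentPolynomial.T (-(p i).sign) else LaurentPolynomial.T (p i).sign) *
        Polynomial.aeval conwayVar (torusConway (p i)) +
      Polynomial.aeval conwayVar (torusConway (towardsZero (p i))) := by
  have hall : ∀ k s, edgeUp o i k s = a := by
    intro k s
    rw [edgeUp_eq]
    cases s <;> simp [h0, h1]
  have hw := fun c : Fin (p i).natAbs =>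
    o.weight_of_parallel (⟨i, c⟩ : Σ i : Fin n, Fin (p i).natAbs) (hall c.succ true)
      (hall c.succ false)
  have hs : ∀ c : Fin (p i).natAbs,
      o.crossingSign (⟨i, c⟩ : Σ i : Fin n, Fin (p i).natAbs) = (p i).sign := fun c =>
    (o.crossingSign_of_parallel _ (hall c.succ true) (hall c.succ false)).trans
      (if_pos_eq_sign hi)
  have hadd := LaurentPolynomial.T_add_neg_T_neg (Int.sign_eq_one_or_neg_one hi)
  have hmul := LaurentPolynomial.T_mul_neg_T_neg (p i).sign
  have hadd' := (add_comm _ _).trans hadd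
  have hmul' := (mul_comm _ _).trans hmul
  have hne : (p i).natAbs ≠ 0 := Int.natAbs_ne_zero.2 hi
  have w0 : ∀ c, pretzelWeight o i c 0 = if a then LaurentPolynomial.T (p i).sign
      else -LaurentPolynomial.T (-(p i).sign) := fun c => by
    rw [← hs c]; exact (hw c).1
  have w2 : ∀ c, pretzelWeight o i c 2 = if a then -LaurentPolynomial.T (-(p i).sign)
      else LaurentPolynomial.T (p i).sign := fun c => by
    rw [← hs c]; exact (hw c).2.2.1
  have w1 : ∀ c, pretzelWeight o i c 1 = 1 := fun c => (hw c).2.1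
  have w3 : ∀ c, pretzelWeight o i c 3 = 1 := fun c => (hw c).2.2.2
  rw [torusConway_towardsZero hi, torusConway_eq]
  cases a
  · refine ⟨?_, ?_, ?_⟩
    · rw [switchSum_of_d_one w0 w2 w3]
      exact (aeval_torusPolynomial hadd' hmul' _).symm
    · rw [switchSum_of_d_one w0 w2 w1]
      exact (aeval_torusPolynomial hadd' hmul' _).symm
    · simp only [w2, Finset.prod_const, Finset.card_univ, Fintype.card_fin]
      exact pow_eq_aeval_torusPolynomial hadd hmul hne
  · refine ⟨?_, ?_, ?_⟩
    · rw [switchSum_of_d_one w0 w2 w3]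
      exact (aeval_torusPolynomial hadd hmul _).symm
    · rw [switchSum_of_d_one w0 w2 w1]
      exact (aeval_torusPolynomial hadd hmul _).symm
    · simp only [w2, Finset.prod_const, Finset.card_univ, Fintype.card_fin]
      exact pow_eq_aeval_torusPolynomial hadd' hmul' hne

/-- The weights of a column with antiparallel strands. -/
theorem antiparallel_weights {i : Fin n} {a : Bool} (h0 : edgeUp o i 0 false = a)
    (h1 : edgeUp o i 0 true = !a) (c : Fin (p i).natAbs) :
    pretzelWeight o i c 0 = 1 ∧ pretzelWeight o i c 2 = 1 ∧
    pretzelWeight o i c 3 = (if Even c.1 ↔ a = true then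
      LaurentPolynomial.T (if 0 < p i then -1 else 1)
      else -LaurentPolynomial.T (-(if 0 < p i then -1 else 1))) ∧
    pretzelWeight o i c 1 = (if Even c.1 ↔ a = true then
      -LaurentPolynomial.T (-(if 0 < p i then -1 else 1))
      else LaurentPolynomial.T (if 0 < p i then -1 else 1)) := by
  obtain ⟨b, hb⟩ : ∃ b : Bool, b = true ↔ (Even c.1 ↔ a = true) :=
    ⟨decide (Even c.1 ↔ a = true), decide_eq_true_iff⟩
  have e0 : edgeUp o i c.succ true = b := by
    rw [← Bool.not_false, ← edgeUp_castSucc, edgeUp_eq, Bool.not_false, h0, h1, Fin.val_castSucc]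
    by_cases he : Even c.1 <;> cases a <;> cases b <;> simp_all
  have e1 : edgeUp o i c.succ false = !b := by
    rw [← Bool.not_true, ← edgeUp_castSucc, edgeUp_eq, Bool.not_true, h0, h1, Fin.val_castSucc]
    by_cases he : Even c.1 <;> cases a <;> cases b <;> simp_all
  have hs : o.crossingSign (⟨i, c⟩ : Σ i : Fin n, Fin (p i).natAbs) =
      if 0 < p i then -1 else 1 := by
    refine (o.crossingSign_of_antiparallel _ e0 e1).trans ?_
    rw [firstOver_pretzelLink]
    simp only [decide_eq_true_eq]
  obtain ⟨w0, w1, w2, w3⟩ :=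
    o.weight_of_antiparallel (⟨i, c⟩ : Σ i : Fin n, Fin (p i).natAbs) e0 e1
  rw [hs] at w1 w3
  simp only [← hb]
  exact ⟨w0, w2, w3, w1⟩

/-- The corners on one side alternate between the weights q^ε and -q^(-ε) with ε opposite to the
sign of `l`, so each pair of crossings contributes εz. -/
theorem antiparallel_even_column {i : Fin n} {l : ℤ} (hi : p i = 2 * l) {a : Bool}
    (h0 : edgeUp o i 0 false = a) (h1 : edgeUp o i 0 true = !a) :
    switchSum (pretzelWeight o i) 3 = -(l : ℤ[T;T⁻¹]) * conwayVar ∧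
    switchSum (pretzelWeight o i) 1 = -(l : ℤ[T;T⁻¹]) * conwayVar ∧
    ∏ c, pretzelWeight o i c 2 = 1 := by
  have hw := antiparallel_weights o h0 h1
  refine ⟨?_, ?_, Finset.prod_eq_one fun c _ => (hw c).2.1⟩
  all_goals
    rw [switchSum_of_ns_one _ (fun c => (hw c).1) (fun c => (hw c).2.1)]
    first
      | rw [Finset.sum_congr rfl fun c _ => (hw c).2.2.1]
      | rw [Finset.sum_congr rfl fun c _ => (hw c).2.2.2]
    cases a <;> simp only [Bool.false_eq_true, iff_false, iff_true, ite_not] <;>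
      rw [Fin.sum_univ_eq_sum_range fun k => if Even k then _ else _,
        show (p i).natAbs = 2 * l.natAbs by omega, Finset.sum_range_ite_even]
  all_goals
    rcases lt_or_ge 0 l with h | h
    · rw [if_pos (by omega), show (l.natAbs : ℤ[T;T⁻¹]) = (l : ℤ[T;T⁻¹]) by
        rw [← Int.cast_natCast, Int.natAbs_of_nonneg h.le]]
      simp only [neg_neg]
      ring
    · rw [if_neg (by omega), show (l.natAbs : ℤ[T;T⁻¹]) = -(l : ℤ[T;T⁻¹]) by
        rw [← Int.cast_natCast, Int.ofNat_natAbs_of_nonpos h, Int.cast_neg]]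
      ring

/-- As in the even case, but one corner remains unpaired. The same expression serves both signs of
`p i` because q = q⁻¹ + z; for negative `p i` there are `-k - 1` pairs. -/
theorem antiparallel_odd_column {i : Fin n} {k : ℤ} (hi : p i = 2 * k + 1) {a : Bool}
    (h0 : edgeUp o i 0 false = a) (h1 : edgeUp o i 0 true = !a) :
    switchSum (pretzelWeight o i) 3 =
      (if a then LaurentPolynomial.T (-1) else -LaurentPolynomial.T 1) - (k : ℤ[T;T⁻¹]) * conwayVar ∧
    switchSum (pretzelWeight o i) 1 =
      (if a then -LaurentPolynomial.T 1 else LaurentPolynomial.T (-1)) - (k : ℤ[T;T⁻¹]) * conwayVar ∧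
    ∏ c, pretzelWeight o i c 2 = 1 := by
  have hw := antiparallel_weights o h0 h1
  refine ⟨?_, ?_, Finset.prod_eq_one fun c _ => (hw c).2.1⟩
  all_goals
    rw [switchSum_of_ns_one _ (fun c => (hw c).1) (fun c => (hw c).2.1)]
    first
      | rw [Finset.sum_congr rfl fun c _ => (hw c).2.2.1]
      | rw [Finset.sum_congr rfl fun c _ => (hw c).2.2.2]
    rcases lt_or_ge 0 (p i) with h | h
    · obtain ⟨r, rfl⟩ : ∃ r : ℕ, k = r := ⟨k.toNat, by omega⟩
      cases a <;> simp only [Bool.false_eq_true, iff_false, iff_true, ite_not, if_pos h,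
        if_false, if_true] <;>
        rw [Fin.sum_univ_eq_sum_range fun k => if Even k then _ else _,
          show (p i).natAbs = 2 * r + 1 by omega, Finset.sum_range_succ,
          Finset.sum_range_ite_even, if_pos (even_two_mul r)] <;>
        simp only [neg_neg, Int.cast_natCast] <;> ring
    · obtain ⟨r, rfl⟩ : ∃ r : ℕ, k = -r - 1 := ⟨(-k - 1).toNat, by omega⟩
      cases a <;> simp only [Bool.false_eq_true, iff_false, iff_true, ite_not, if_neg h.not_gt,
        if_false, if_true] <;>
        rw [Fin.sum_univ_eq_sum_range fun k => if Even k then _ else _,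
          show (p i).natAbs = 2 * r + 1 by omega, Finset.sum_range_succ,
          Finset.sum_range_ite_even, if_pos (even_two_mul r)] <;>
        push_cast <;> ring

end Pretzel

theorem Fin.induction_sub_one {n : ℕ} [NeZero n] {P : Fin n → Prop} (h0 : P 0)
    (hs : ∀ i, i ≠ 0 → P (i - 1) → P i) (i : Fin n) : P i := by
  obtain ⟨r, hr⟩ := i
  induction r with
  | zero => exact h0
  | succ r ih =>
    have h1 : (⟨r + 1, hr⟩ : Fin n) - 1 = ⟨r, by omega⟩ := by simp [Fin.sub_one_eq_iff_val]
    refine hs _ (by simp [Fin.ext_iff]) ?_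
    rw [h1]
    exact ih (by omega)

theorem Fin.val_sub_one_add_one {n : ℕ} [NeZero n] {i : Fin n} (hi : i ≠ 0) :
    (i - 1).1 + 1 = i.1 := by
  rcases (Fin.sub_one_eq_iff_val i (i - 1)).1 rfl with h | ⟨h, -⟩
  · exact h.symm
  · exact absurd (Fin.val_eq_zero_iff.1 h) hi

theorem Fin.val_zero_sub_one_add_one {n : ℕ} [NeZero n] : ((0 : Fin n) - 1).1 + 1 = n := by
  rcases (Fin.sub_one_eq_iff_val (0 : Fin n) (0 - 1)).1 rfl with h | ⟨-, h⟩
  · exact absurd h (by simp)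
  · exact h

section Orientation

variable {n : ℕ} [NeZero n] {p : Fin n → ℤ} (o : (pretzelLink p).Orientation)

/-- This is the condition at the top joint, carried to the bottom: an odd column exchanges its two
sides. -/
theorem edgeUp_zero_true_of_odd {i : Fin n} (hi : Odd (p i)) (hi' : Odd (p (i - 1))) :
    edgeUp o i 0 true = !edgeUp o (i - 1) 0 false := by
  have h := edgeUp_last_false o i
  rwa [edgeUp_last_of_odd o hi, edgeUp_last_of_odd o hi'] at h

theorem edgeUp_zero_true_of_odd_of_even {i : Fin n} (hi : Odd (p i)) (hi' : Even (p (i - 1))) :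
    edgeUp o i 0 true = !edgeUp o (i - 1) 0 true := by
  have h := edgeUp_last_false o i
  rwa [edgeUp_last_of_odd o hi, edgeUp_last_of_even o hi'] at h

theorem edgeUp_of_antiparallel (h : ∀ i, edgeUp o i 0 true = !edgeUp o i 0 false) (i : Fin n) :
    edgeUp o i 0 false = edgeUp o 0 0 false := by
  induction i using Fin.induction_sub_one with
  | h0 => rfl
  | hs i hi ih => rw [edgeUp_zero_false, h, Bool.not_not, ih]

theorem edgeUp_of_parallel (h : ∀ i, edgeUp o i 0 true = edgeUp o i 0 false) (i : Fin n) :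
    edgeUp o i 0 false = if Even i.1 then edgeUp o 0 0 false else !edgeUp o 0 0 false := by
  induction i using Fin.induction_sub_one with
  | h0 => simp
  | hs i hi ih =>
    rw [edgeUp_zero_false, h, ih, ← Fin.val_sub_one_add_one hi]
    simp only [Nat.even_add_one]
    split_ifs <;> simp

/-- If all columns and their number are odd, the strands of all columns are antiparallel. -/
theorem antiparallel_of_odd (hn : Odd n) (hp : ∀ i, Odd (p i)) (i : Fin n) :
    edgeUp o i 0 true = !edgeUp o i 0 false := by
  have h0 : edgeUp o 0 0 true = !edgeUp o 0 0 false := by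
    -- A parallel first column would make every column parallel with alternating directions, which
    -- cannot close up around an odd cycle.
    by_contra hne
    have hpar : ∀ i, edgeUp o i 0 true = edgeUp o i 0 false := by
      intro i
      induction i using Fin.induction_sub_one with
      | h0 => exact Bool.eq_not.not_left.1 hne
      | hs i hi ih =>
        rw [edgeUp_zero_true_of_odd o (hp _) (hp _), edgeUp_zero_false o i, ih]
    have h1 := edgeUp_of_parallel o hpar (0 - 1)
    have h2 := edgeUp_zero_false o 0
    rw [hpar, h1, if_pos] at h2
    · simp at h2
    · have := Fin.val_zero_sub_one_add_one (n := n)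
      rw [← this, Nat.odd_add_one, Nat.not_odd_iff_even] at hn
      exact hn
  induction i using Fin.induction_sub_one with
  | h0 => exact h0
  | hs i hi ih =>
    rw [edgeUp_zero_true_of_odd o (hp _) (hp _), edgeUp_zero_false o i, ih]
    simp

/-- If only the first column is even, the strands of the other columns are parallel, with
alternating directions. -/
theorem parallel_of_even (h0 : Even (p 0)) (hp : ∀ i, i ≠ 0 → Odd (p i)) (i : Fin n) :
    (edgeUp o i 0 true = if Even i.1 then edgeUp o 0 0 true else !edgeUp o 0 0 true) ∧
    (i ≠ 0 → edgeUp o i 0 false = edgeUp o i 0 true) := by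
  induction i using Fin.induction_sub_one with
  | h0 => simp
  | hs i hi ih =>
    have h1 : edgeUp o i 0 true = !edgeUp o (i - 1) 0 true := by
      by_cases hi' : i - 1 = 0
      · exact edgeUp_zero_true_of_odd_of_even o (hp i hi) (by rwa [hi'])
      · rw [edgeUp_zero_true_of_odd o (hp i hi) (hp _ hi'), ih.2 hi']
    refine ⟨?_, fun _ => (edgeUp_zero_false o i).trans h1.symm⟩
    rw [h1, ih.1, ← Fin.val_sub_one_add_one hi]
    simp only [Nat.even_add_one]
    split_ifs <;> simp

/-- The alternation of `parallel_of_even`, followed through to the last column, returns to column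
`0` at the bottom joint; the parity of `n` decides the outcome. -/
theorem edgeUp_first_of_even (h0 : Even (p 0)) (hp : ∀ i, i ≠ 0 → Odd (p i)) :
    edgeUp o 0 0 true = if Even n then edgeUp o 0 0 false else !edgeUp o 0 0 false := by
  have h1 := edgeUp_zero_false o 0
  have h2 := (parallel_of_even o h0 hp (0 - 1)).1
  have h3 := Fin.val_zero_sub_one_add_one (n := n)
  have h4 : Even n ↔ ¬ Even ((0 : Fin n) - 1).1 := by rw [← Nat.even_add_one, h3]
  rw [h1, h2]
  simp only [h4]
  split_ifs <;> simp

theorem sameDirection_iff (i : Fin n) :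
    SameDirection o i ↔ edgeUp o i 0 true = edgeUp o i 0 false :=
  eq_comm

end Orientation

/-! ### Sums of products -/

section CrossSum

variable {ι R : Type*} [DecidableEq ι] [CommRing R]

/-- The sum of all products of `V` over `s` with one factor replaced by the factor of `U`. -/
def crossSum (s : Finset ι) (V U : ι → R) : R :=
  ∑ j ∈ s, U j * ∏ i ∈ s.erase j, V i

theorem crossSum_eq_erase {s : Finset ι} {a : ι} (ha : a ∈ s) (V U : ι → R) :
    crossSum s V U = U a * ∏ i ∈ s.erase a, V i + V a * crossSum (s.erase a) V U := by
  unfold crossSum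
  rw [← Finset.add_sum_erase s _ ha, Finset.mul_sum]
  congr 1
  refine Finset.sum_congr rfl fun j hj => ?_
  rw [← Finset.mul_prod_erase (s.erase j) V (a := a), Finset.erase_right_comm]
  · ring
  · exact Finset.mem_erase.2 ⟨(Finset.ne_of_mem_erase hj).symm, ha⟩

/-- A part of `U` that is a multiple of `V` restores the missing factor, so it contributes a
multiple of the full product. -/
theorem crossSum_linear {s : Finset ι} {V U U' t : ι → R} (h : ∀ i ∈ s, U i = t i * V i + U' i) :
    crossSum s V U = (∑ i ∈ s, t i) * ∏ i ∈ s, V i + crossSum s V U' := by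
  unfold crossSum
  rw [Finset.sum_mul, ← Finset.sum_add_distrib]
  refine Finset.sum_congr rfl fun j hj => ?_
  rw [h j hj, ← Finset.mul_prod_erase s V hj]
  ring

theorem crossSum_congr {s : Finset ι} {V V' U U' : ι → R} (h : ∀ i ∈ s, V i = V' i)
    (h' : ∀ i ∈ s, U i = U' i) : crossSum s V U = crossSum s V' U' := by
  unfold crossSum
  refine Finset.sum_congr rfl fun j hj => ?_
  rw [h' j hj, Finset.prod_congr rfl fun i hi => h i (Finset.mem_of_mem_erase hi)]

theorem map_crossSum {S F : Type*} [CommRing S] [FunLike F R S] [RingHomClass F R S] (f : F)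
    (s : Finset ι) (V U : ι → R) :
    f (crossSum s V U) = crossSum s (fun i => f (V i)) fun i => f (U i) := by
  simp only [crossSum, map_sum, map_mul, map_prod]

theorem crossSum_eq_prod_mul_sum_div {K : Type*} [Field K] {s : Finset ι} {V U : ι → K}
    (h : ∀ i ∈ s, V i ≠ 0) : crossSum s V U = (∏ i ∈ s, V i) * ∑ i ∈ s, U i / V i := by
  unfold crossSum
  rw [Finset.mul_sum]
  refine Finset.sum_congr rfl fun j hj => ?_
  rw [← Finset.mul_prod_erase s V hj]
  field_simp [h j hj]

theorem sum_prod_ite_eq_crossSum {n : ℕ} (E S W V : Fin n → R) (hE : ∀ i, E i = V i)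
    (hW : ∀ i, W i = V i) :
    ∑ j, ∏ i, (if i < j then E i else if i = j then S i else W i) =
      crossSum Finset.univ V S := by
  unfold crossSum
  refine Finset.sum_congr rfl fun j _ => ?_
  rw [← Finset.mul_prod_erase Finset.univ _ (Finset.mem_univ j), if_neg (lt_irrefl j), if_pos rfl]
  congr 1
  refine Finset.prod_congr rfl fun i hi => ?_
  rw [if_neg (Finset.ne_of_mem_erase hi), hE, hW, ite_self]

end CrossSum

/-! ### Columns with parallel strands -/

/-- Since q⁻¹ = q - z, the south weight is a multiple of z plus or minus q. The sign of q depends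
only on the direction of the strands, so these terms cancel when directions alternate over an even
number of columns. -/
theorem exists_half_sign {ε : ℤ} (hε : ε = 1 ∨ ε = -1) (a : Bool) :
    ∃ c : ℤ, 2 * c = ε - (if a then -1 else 1) ∧
      (if a then -LaurentPolynomial.T (-ε) else LaurentPolynomial.T ε : ℤ[T;T⁻¹]) =
        (c : ℤ[T;T⁻¹]) * conwayVar + ((if a then -1 else 1 : ℤ) : ℤ[T;T⁻¹]) * LaurentPolynomial.T 1 := by
  rcases hε with rfl | rfl <;> cases a
  · exact ⟨0, by simp, by simp⟩
  · exact ⟨1, by simp, by simp; ring⟩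
  · exact ⟨-1, by simp, by simp⟩
  · exact ⟨0, by simp, by simp⟩

theorem exists_half_sum_sign {ι : Type*} (s : Finset ι) (m : ι → ℤ) (hm : ∀ i, m i ≠ 0)
    (a : ι → Bool) (ha : ∑ i ∈ s, (if a i then -1 else 1 : ℤ) = 0) :
    ∃ c : ℤ, 2 * c = ∑ i ∈ s, (m i).sign ∧
      ∑ i ∈ s, (if a i then -LaurentPolynomial.T (-(m i).sign)
        else LaurentPolynomial.T (m i).sign : ℤ[T;T⁻¹]) = (c : ℤ[T;T⁻¹]) * conwayVar := by
  choose c hc hc' using fun i => exists_half_sign (Int.sign_eq_one_or_neg_one (hm i)) (a i)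
  refine ⟨∑ i ∈ s, c i, ?_, ?_⟩
  · rw [Finset.mul_sum, Finset.sum_congr rfl fun i _ => hc i, Finset.sum_sub_distrib, ha, sub_zero]
  · rw [Finset.sum_congr rfl fun i _ => hc' i, Finset.sum_add_distrib, ← Finset.sum_mul,
      ← Finset.sum_mul, ← Int.cast_sum, ← Int.cast_sum, ha]
    simp

theorem sum_alternating_of_even {n : ℕ} (hn : Even n) (w : Bool) :
    ∑ i : Fin n, (if (if Even i.1 then w else !w) = true then -1 else 1 : ℤ) = 0 := by
  obtain ⟨r, hr⟩ := hn
  have h : ∀ i : Fin n, (if (if Even i.1 then w else !w) = true then -1 else 1 : ℤ) =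
      (fun k : ℕ => if Even k then (if w then -1 else 1 : ℤ) else (if w then 1 else -1)) i := by
    intro i
    cases w <;> by_cases hi : Even i.1 <;> simp [hi]
  rw [Finset.sum_congr rfl fun i _ => h i,
    Fin.sum_univ_eq_sum_range (fun k : ℕ => if Even k then (if w then -1 else 1 : ℤ)
      else (if w then 1 else -1)), show n = 2 * r by omega, Finset.sum_range_ite_even]
  cases w <;> simp

theorem sum_alternating_of_odd {n : ℕ} [NeZero n] (hn : Odd n) (w : Bool) :
    ∑ i ∈ Finset.univ.erase (0 : Fin n),
      (if (if Even i.1 then w else !w) = true then -1 else 1 : ℤ) = 0 := by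
  obtain ⟨r, rfl⟩ := hn
  have h := Finset.add_sum_erase Finset.univ
    (fun i : Fin (2 * r + 1) => (if (if Even i.1 then w else !w) = true then -1 else 1 : ℤ))
    (Finset.mem_univ 0)
  have h2 := sum_alternating_of_even (n := 2 * r) (even_two_mul r) w
  rw [Fin.sum_univ_castSucc] at h
  simp only [Fin.val_castSucc, h2, Fin.val_last, Fin.val_zero, even_two_mul, if_true,
    Even.zero] at h
  linarith

section Pretzel

variable {n : ℕ} [NeZero n] {p : Fin n → ℤ} (o : (pretzelLink p).Orientation)

theorem hasConwayPolynomial_of_parallel (hn : Even n) (hp : ∀ i, p i ≠ 0)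
    (h : ∀ i, edgeUp o i 0 true = edgeUp o i 0 false) :
    ∃ c : ℤ, 2 * c = ∑ i, (p i).sign ∧ o.HasConwayPolynomial (pretzelBase p)
      (Polynomial.C c * Polynomial.X * ∏ i, torusConway (p i) +
        crossSum Finset.univ (fun i => torusConway (p i))
          fun i => torusConway (towardsZero (p i))) := by
  obtain ⟨c, hc, hc'⟩ := exists_half_sum_sign Finset.univ p hp (fun i => edgeUp o i 0 false) 
    ((Finset.sum_congr rfl fun i _ => by rw [edgeUp_of_parallel o h i]).trans
      (sum_alternating_of_even hn (edgeUp o 0 0 false)))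
  refine ⟨c, hc, ?_⟩
  have hcol := fun i => parallel_column o (hp i) rfl (h i)
  unfold Orientation.HasConwayPolynomial
  rw [pretzel_stateSum fun i _ => hp i, sum_prod_ite_eq_crossSum _ _ _ _ (fun i => (hcol i).1)
    (fun i => (hcol i).2.1), crossSum_linear (fun i _ => (hcol i).2.2), hc']
  simp only [map_add, map_mul, map_prod, Polynomial.aeval_X, eq_intCast, map_intCast,
    map_crossSum (Polynomial.aeval (R := ℤ) conwayVar)]

theorem hasConwayPolynomial_of_first_antiparallel (hn : Odd n) {l : ℤ} (h0 : p 0 = 2 * l)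
    (hp : ∀ i, i ≠ 0 → Odd (p i)) :
    ∃ c : ℤ, 2 * c = ∑ i ∈ Finset.univ.erase 0, (p i).sign ∧
      o.HasConwayPolynomial (pretzelBase p)
      (∏ i ∈ Finset.univ.erase 0, torusConway (p i) - Polynomial.C l * Polynomial.X *
        (Polynomial.C c * Polynomial.X * ∏ i ∈ Finset.univ.erase 0, torusConway (p i) +
        crossSum (Finset.univ.erase 0) (fun i => torusConway (p i))
          fun i => torusConway (towardsZero (p i)))) := by
  have h0' : Even (p 0) := h0 ▸ even_two_mul l
  have hpar := parallel_of_even o h0' hp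
  have hne : ∀ i, i ≠ 0 → p i ≠ 0 := fun i hi h => by simpa [h] using hp i hi
  have hanti : edgeUp o 0 0 true = !edgeUp o 0 0 false := by
    rw [edgeUp_first_of_even o h0' hp, if_neg (Nat.not_even_iff_odd.2 hn)]
  -- The value 1 at index `0` is a dummy: the lemma wants nonzero integers everywhere and `p 0` may
  -- vanish. `hif` removes it again.
  obtain ⟨c, hc, hc'⟩ := exists_half_sum_sign (Finset.univ.erase 0)
    (fun i => if i = 0 then 1 else p i) (fun i => by
      split_ifs with hi
      · exact one_ne_zero
      · exact hne i hi) (fun i => edgeUp o i 0 true)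
    ((Finset.sum_congr rfl fun i _ => by rw [(hpar i).1]).trans
      (sum_alternating_of_odd hn (edgeUp o 0 0 true)))
  have hif : ∀ i ∈ Finset.univ.erase (0 : Fin n), (if i = 0 then 1 else p i) = p i := fun i hi =>
    if_neg (Finset.ne_of_mem_erase hi)
  rw [Finset.sum_congr rfl fun i hi => by rw [hif i hi]] at hc hc'
  refine ⟨c, hc, ?_⟩
  have hcol := fun i (hi : i ≠ 0) => parallel_column o (hne i hi) ((hpar i).2 hi) rfl
  obtain ⟨hE, hW, hS⟩ := antiparallel_even_column o h0 rfl hanti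
  unfold Orientation.HasConwayPolynomial
  -- East and west sums agree in every column, the first included, so the state sum is a `crossSum`;
  -- splitting off column `0` leaves only parallel columns.
  rw [pretzel_stateSum hne, sum_prod_ite_eq_crossSum _ _ _
    (fun i => if i = 0 then -(l : ℤ[T;T⁻¹]) * conwayVar
      else Polynomial.aeval conwayVar (torusConway (p i))) (fun i => ?_) (fun i => ?_),
    crossSum_eq_erase (Finset.mem_univ 0), if_pos rfl, hS,
    crossSum_congr (U' := fun i => ∏ c, pretzelWeight o i c 2)
      (V' := fun i => Polynomial.aeval conwayVar (torusConway (p i)))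
      (fun i hi => if_neg (Finset.ne_of_mem_erase hi)) (fun i _ => rfl),
    crossSum_linear (fun i hi => (hcol i (Finset.ne_of_mem_erase hi)).2.2), hc',
    Finset.prod_congr rfl fun i hi => if_neg (Finset.ne_of_mem_erase hi)]
  · simp only [map_add, map_sub, map_mul, map_prod, Polynomial.aeval_X, eq_intCast,
      map_intCast, map_crossSum (Polynomial.aeval (R := ℤ) conwayVar)]
    ring
  · split_ifs with hi
    · subst hi
      exact hE
    · exact (hcol i hi).1
  · split_ifs with hi
    · subst hi
      exact hW
    · exact (hcol i hi).2.1

end Pretzel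

/-! ### Columns with antiparallel strands -/

/-- Because u² = 1 - zu, the products of the factors `u - k i * z` stay in the span of 1 and `u`
over polynomials in z. Appending a column sends the sum Q to Q(v - rz) + (P + uQ), and u + v = -z
turns this into P - (1 + r)zQ, which is again the coefficient of `u` in the longer product. Both
recursions raise degree and parity by one. -/
theorem exists_parity_polynomials {R : Type*} [CommRing R] {u v z : R} (hadd : u + v = -z)
    (hmul : u * v = -1) {n : ℕ} (k : Fin n → ℤ) :
    ∃ P Q : ℤ[X], (∀ i, P.coeff i ≠ 0 → i ≤ n ∧ Even (n + i)) ∧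
      (∀ i, Q.coeff i ≠ 0 → i + 1 ≤ n ∧ Odd (n + i)) ∧
      ∏ i, (u - (k i : R) * z) = Polynomial.aeval z P + u * Polynomial.aeval z Q ∧
      ∑ j, ∏ i, (if i < j then u - (k i : R) * z else if i = j then 1 else v - (k i : R) * z) =
        Polynomial.aeval z Q := by
  induction n with
  | zero =>
    refine ⟨1, 0, fun i hi => ?_, fun i hi => by simp at hi, by simp, by simp⟩
    rw [Polynomial.coeff_one] at hi
    have h0 : i = 0 := by
      by_contra h
      exact hi (if_neg h)
    simp [h0]
  | succ n ih =>
    obtain ⟨P, Q, hP, hQ, hE, hG⟩ := ih fun i => k i.castSucc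
    set r := k (Fin.last n) with hr
    refine ⟨Q - Polynomial.C r * (P * Polynomial.X),
      P - Polynomial.C (1 + r) * (Q * Polynomial.X), fun i hi => ?_, fun i hi => ?_, ?_, ?_⟩
    · have h : Q.coeff i ≠ 0 ∨ (P * Polynomial.X).coeff i ≠ 0 := by
        by_contra! h
        rw [Polynomial.coeff_sub, Polynomial.coeff_C_mul, h.1, h.2] at hi
        simp at hi
      rcases h with h | h
      · obtain ⟨h1, h2⟩ := hQ i h
        refine ⟨by omega, ?_⟩
        rw [Nat.even_iff]
        rw [Nat.odd_iff] at h2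
        omega
      · rcases i with _ | i
        · simp at h
        · rw [Polynomial.coeff_mul_X] at h
          obtain ⟨h1, h2⟩ := hP i h
          refine ⟨by omega, ?_⟩
          rw [Nat.even_iff] at h2 ⊢
          omega
    · have h : P.coeff i ≠ 0 ∨ (Q * Polynomial.X).coeff i ≠ 0 := by
        by_contra! h
        rw [Polynomial.coeff_sub, Polynomial.coeff_C_mul, h.1, h.2] at hi
        simp at hi
      rcases h with h | h
      · obtain ⟨h1, h2⟩ := hP i h
        refine ⟨by omega, ?_⟩
        rw [Nat.odd_iff]
        rw [Nat.even_iff] at h2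
        omega
      · rcases i with _ | i
        · simp at h
        · rw [Polynomial.coeff_mul_X] at h
          obtain ⟨h1, h2⟩ := hQ i h
          refine ⟨by omega, ?_⟩
          rw [Nat.odd_iff] at h2 ⊢
          omega
    · rw [Fin.prod_univ_castSucc, hE]
      simp only [map_sub, map_mul, map_add, map_one, eq_intCast, map_intCast, Polynomial.aeval_X]
      linear_combination (u * Polynomial.aeval z Q) * hadd - Polynomial.aeval z Q * hmul
    · have h1 : ∀ j : Fin n, (∏ i : Fin (n + 1), (if i < j.castSucc then u - (k i : R) * z
          else if i = j.castSucc then 1 else v - (k i : R) * z)) =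
          (∏ i : Fin n, (if i < j then u - (k i.castSucc : R) * z
          else if i = j then 1 else v - (k i.castSucc : R) * z)) * (v - (r : R) * z) := by
        intro j
        rw [Fin.prod_univ_castSucc]
        congr 1
        · simp
        · rw [if_neg (Fin.castSucc_lt_last j).not_gt, if_neg (Fin.castSucc_lt_last j).ne']
      have h2 : (∏ i : Fin (n + 1), (if i < Fin.last n then u - (k i : R) * z
          else if i = Fin.last n then 1 else v - (k i : R) * z)) =
          ∏ i : Fin n, (u - (k i.castSucc : R) * z) := by
        rw [Fin.prod_univ_castSucc]
        simp [Fin.castSucc_lt_last]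
      rw [Fin.sum_univ_castSucc, Finset.sum_congr rfl fun j _ => h1 j, ← Finset.sum_mul, hG, h2, hE]
      simp only [map_sub, map_mul, map_add, map_one, eq_intCast, map_intCast, Polynomial.aeval_X]
      linear_combination Polynomial.aeval z Q * hadd

theorem Polynomial.eq_sum_of_coeff {Q : ℤ[X]} {J : Finset ℕ} {e : ℕ → ℕ} (he : Set.InjOn e J)
    (h : ∀ j, Q.coeff j ≠ 0 → ∃ i ∈ J, e i = j) :
    Q = ∑ i ∈ J, Polynomial.C (Q.coeff (e i)) * Polynomial.X ^ e i := by
  conv_lhs => rw [Polynomial.as_sum_support_C_mul_X_pow Q]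
  rw [← Finset.sum_image (f := fun j => Polynomial.C (Q.coeff j) * Polynomial.X ^ j) he]
  refine Finset.sum_subset (fun j hj => ?_) fun j _ hj => ?_
  · exact Finset.mem_image.2 (h j (Polynomial.mem_support_iff.1 hj))
  · rw [Polynomial.notMem_support_iff.1 hj]
    simp

section Pretzel

variable {n : ℕ} [NeZero n] {p : Fin n → ℤ} (o : (pretzelLink p).Orientation)

theorem hasConwayPolynomial_of_antiparallel (hp : ∀ i, Odd (p i))
    (h : ∀ i, edgeUp o i 0 true = !edgeUp o i 0 false) :
    ∃ Q : ℤ[X], (∀ i, Q.coeff i ≠ 0 → i + 1 ≤ n ∧ Odd (n + i)) ∧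
      o.HasConwayPolynomial (pretzelBase p) Q := by
  choose k hk using hp
  have hne : ∀ i, p i ≠ 0 := fun i => by have := hk i; omega
  have hcol := fun i => antiparallel_odd_column o (hk i)
    (edgeUp_of_antiparallel o h i) ((h i).trans (by rw [edgeUp_of_antiparallel o h i]))
  generalize edgeUp o 0 0 false = a at hcol
  obtain ⟨P, Q, -, hQ, -, hG⟩ := exists_parity_polynomials (z := conwayVar)
    (u := if a then LaurentPolynomial.T (-1) else -LaurentPolynomial.T 1)
    (v := if a then -LaurentPolynomial.T 1 else LaurentPolynomial.T (-1))
    (by cases a <;> simp only [Bool.false_eq_true, if_true, if_false] <;> ring)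
    (by
      have := LaurentPolynomial.T_mul_neg_T_neg 1
      cases a <;> simp only [Bool.false_eq_true, if_true, if_false] <;> linear_combination this) k
  refine ⟨Q, hQ, ?_⟩
  unfold Orientation.HasConwayPolynomial
  rw [pretzel_stateSum fun i _ => hne i]
  refine hG.symm.trans (Finset.sum_congr rfl fun j _ => Finset.prod_congr rfl fun i _ => ?_)
  rw [(hcol i).1, (hcol i).2.1, (hcol i).2.2]

end Pretzel

/-! ### The five formulas -/

theorem toFrac_crossSum_torusConway {n : ℕ} {p : Fin n → ℤ} {s : Finset (Fin n)}
    (hp : ∀ i ∈ s, Odd (p i)) :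
    toFrac (crossSum s (fun i => torusConway (p i)) fun i => torusConway (towardsZero (p i))) =
      (∏ i ∈ s, toFrac (torusConway (p i))) *
        ∑ i ∈ s, toFrac (torusConway (towardsZero (p i))) / toFrac (torusConway (p i)) := by
  rw [map_crossSum]
  refine crossSum_eq_prod_mul_sum_div fun i hi => ?_
  rw [ne_eq, map_eq_zero_iff _ (IsFractionRing.injective ℤ[X] (FractionRing ℤ[X]))]
  exact torusConway_ne_zero_of_odd (hp i hi)

theorem toFrac_C (c : ℤ) : toFrac (Polynomial.C c) = (c : FractionRing ℤ[X]) := by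
  rw [eq_intCast, map_intCast]

theorem intCast_div_two_of_two_mul_eq {c s : ℤ} (h : 2 * c = s) :
    (s : FractionRing ℤ[X]) / 2 = c := by
  rw [← h]
  push_cast
  field_simp

theorem mainTheorem3 {n : ℕ} [NeZero n] (p : Fin n → ℤ) (o : (pretzelLink p).Orientation) :
    -- n odd, all boxes odd
    (Odd n → (∀ i, Odd (p i)) →
      ∃ a : ℕ → ℤ, o.HasConwayPolynomial (pretzelBase p)
        (∑ i ∈ Finset.range ((n - 1) / 2 + 1), Polynomial.C (a i) * Polynomial.X ^ (2 * i))) ∧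
    -- n odd, the first box even, all others odd
    (∀ l : ℤ, Odd n → p 0 = 2 * l → (∀ i, i ≠ 0 → Odd (p i)) →
      ∃ P : ℤ[X], o.HasConwayPolynomial (pretzelBase p) P ∧
        toFrac P = (∏ i ∈ Finset.univ.erase 0, toFrac (torusConway (p i))) *
          (1 - (l : FractionRing ℤ[X]) * toFrac Polynomial.X *
            (((∑ i ∈ Finset.univ.erase 0, (p i).sign : ℤ) : FractionRing ℤ[X]) / 2 * toFrac Polynomial.X +
              ∑ i ∈ Finset.univ.erase 0,
                toFrac (torusConway (towardsZero (p i))) / toFrac (torusConway (p i))))) ∧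
    -- n even, the first box even, all others odd
    (Even n → Even (p 0) → p 0 ≠ 0 → (∀ i, i ≠ 0 → Odd (p i)) →
      ∃ P : ℤ[X], o.HasConwayPolynomial (pretzelBase p) P ∧
        toFrac P = (∏ i ∈ Finset.univ.erase 0, toFrac (torusConway (p i))) *
          (toFrac (torusConway (towardsZero (p 0))) + toFrac (torusConway (p 0)) *
            ((((p 0).sign + ∑ i ∈ Finset.univ.erase 0, (p i).sign : ℤ) : FractionRing ℤ[X]) / 2 *
                toFrac Polynomial.X +
              ∑ i ∈ Finset.univ.erase 0,
                toFrac (torusConway (towardsZero (p i))) / toFrac (torusConway (p i))))) ∧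
    -- n even, all boxes odd, opposite directions in all boxes
    (Even n → (∀ i, Odd (p i)) → (∀ i, ¬ SameDirection o i) →
      ∃ a : ℕ → ℤ, o.HasConwayPolynomial (pretzelBase p)
        (∑ i ∈ Finset.Icc 1 (n / 2), Polynomial.C (a i) * Polynomial.X ^ (2 * i - 1))) ∧
    -- n even, all boxes odd, the same direction in all boxes
    (Even n → (∀ i, Odd (p i)) → (∀ i, SameDirection o i) →
      ∃ P : ℤ[X], o.HasConwayPolynomial (pretzelBase p) P ∧
        toFrac P = (∏ i, toFrac (torusConway (p i))) *
          (((∑ i, (p i).sign : ℤ) : FractionRing ℤ[X]) / 2 * toFrac Polynomial.X +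
            ∑ i, toFrac (torusConway (towardsZero (p i))) / toFrac (torusConway (p i)))) := by
  refine ⟨fun hn hp => ?_, fun l hn h0 hp => ?_, fun hn h0 h0' hp => ?_, fun hn hp h => ?_,
    fun hn hp h => ?_⟩
  · obtain ⟨Q, hQ, hQ'⟩ :=
      hasConwayPolynomial_of_antiparallel o hp (antiparallel_of_odd o hn hp)
    refine ⟨fun i => Q.coeff (2 * i), ?_⟩
    rwa [← Polynomial.eq_sum_of_coeff (fun i _ j _ h => by simpa using h) fun j hj => ?_]
    obtain ⟨h1, h2⟩ := hQ j hj
    rw [Nat.odd_iff] at h2 hn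
    exact ⟨j / 2, by rw [Finset.mem_range]; omega, by omega⟩
  · obtain ⟨c, hc, hP⟩ := hasConwayPolynomial_of_first_antiparallel o hn h0 hp
    refine ⟨_, hP, ?_⟩
    rw [intCast_div_two_of_two_mul_eq hc]
    simp only [map_sub, map_add, map_mul, map_prod, toFrac_C,
      toFrac_crossSum_torusConway fun i hi => hp i (Finset.ne_of_mem_erase hi)]
    ring
  · have hne : ∀ i, p i ≠ 0 := fun i => by
      by_cases hi : i = 0
      · rwa [hi]
      · intro h
        simpa [h] using hp i hi
    -- For even `n` the first column is parallel as well, so the formula for parallel columns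
    -- applies; splitting off column `0` then yields the shape with e₁ and β.
    have hfirst := edgeUp_first_of_even o h0 hp
    rw [if_pos hn] at hfirst
    obtain ⟨c, hc, hP⟩ := hasConwayPolynomial_of_parallel o hn hne fun i => by
      by_cases hi : i = 0
      · rw [hi, hfirst]
      · exact ((parallel_of_even o h0 hp i).2 hi).symm
    refine ⟨_, hP, ?_⟩
    rw [← Finset.add_sum_erase Finset.univ _ (Finset.mem_univ 0)] at hc
    rw [intCast_div_two_of_two_mul_eq hc, crossSum_eq_erase (Finset.mem_univ 0),
      ← Finset.mul_prod_erase Finset.univ _ (Finset.mem_univ 0)]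
    simp only [map_add, map_mul, map_prod, toFrac_C,
      toFrac_crossSum_torusConway fun i hi => hp i (Finset.ne_of_mem_erase hi)]
    ring
  · obtain ⟨Q, hQ, hQ'⟩ := hasConwayPolynomial_of_antiparallel o hp fun i =>
      Bool.eq_not.2 ((sameDirection_iff o i).not.1 (h i))
    refine ⟨fun i => Q.coeff (2 * i - 1), ?_⟩
    rwa [← Polynomial.eq_sum_of_coeff (e := fun i => 2 * i - 1) (fun i hi j hj h => ?_)
      fun j hj => ?_]
    · simp only [Finset.coe_Icc, Set.mem_Icc] at hi hj h
      omega
    · obtain ⟨h1, h2⟩ := hQ j hj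
      rw [Nat.odd_iff] at h2
      rw [Nat.even_iff] at hn
      exact ⟨(j + 1) / 2, by rw [Finset.mem_Icc]; omega, by omega⟩
  · obtain ⟨c, hc, hP⟩ := hasConwayPolynomial_of_parallel o hn
      (fun i hi => by simpa [hi] using hp i) fun i => (sameDirection_iff o i).1 (h i)
    refine ⟨_, hP, ?_⟩
    rw [intCast_div_two_of_two_mul_eq hc]
    simp only [map_add, map_mul, map_prod, toFrac_C,
      toFrac_crossSum_torusConway fun i _ => hp i]
    ring
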